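/- **Theorem.** All rings are associative and unital, not necessarily commutative. A *ring word* in generators $x_0,\dots,x_{n-1}$ is a formal finite sum of integer multiples of monomials in the generators; words are coded by natural numbers in the standard way. A finitely generated ring presentation consists of a number $n$ of generators and a set $R$ of ring words in $x_0,\dots,x_{n-1}$, and it presents the ring $\mathbb Z\langle x_0,\dots,x_{n-1}\rangle/(R)$, where $(R)$ is the two-sided ideal generated by $R$. Its *word problem* is the equivalence relation on the set of words that identifies two words when they have the same value in this ring. The presentation is *computable* (resp. *c.e.*) if $R$ is computable (resp. c.e.); an *index* of it is (the code of) a pair consisting of $n$ and a program that decides $R$ (resp. whose halting set, restricted to words, is $R$). An equivalence relation $E$ is *dark* if it has infinitely many classes and there is no infinite c.e. set whose elements are pairwise $E$-inequivalent. A set $A\subseteq\mathbb N$ is $\Pi^0_3$-complete if it is $\Pi^0_3$ and every $\Pi^0_3$ set is many-one reducible to it. 1. The set of indices of finitely generated computable ring presentations whose word problem is dark is $\Pi^0_3$-complete. 2. The set of indices of finitely generated c.e. ring presentations whose word problem is dark is $\Pi^0_3$-complete. 3. Let $p$ be a prime. For every $\Pi^0_3$ set $S\subseteq\mathbb N$ there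 is a computable function $f:\mathbb N\to\mathbb N$ such that, for every $i$, the number $f(i)$ is an index of a finitely generated computable ring presentation whose word problem is dark if and only if $i\in S$, and the presented ring is isomorphic to $(\mathbb Z/p\mathbb Z)\langle x,y\rangle/(H)$ for some set $H$ of homogeneous noncommutative polynomials that satisfies the Golod–Shafarevich condition: there is a real $\epsilon$ with $0<\epsilon\le 1$ such that the number $n_k$ of nonzero elements of $H$ of degree $k$ satisfies $n_0=n_1=0$ and $n_k\le \epsilon^2(2-2\epsilon)^{k-2}$ for all $k\ge 2$. -/

import Mathlib

namespace DarkRings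

open Nat.Partrec (Code)

/-! ### The class of `Π⁰₃` sets of natural numbers -/

/-- `A` is `Π⁰₃`: it is defined by a prefix `∀ ∃ ∀` in front of a computable predicate. -/
def IsPi03 (A : Set ℕ) : Prop :=
  ∃ R : ℕ × ℕ × ℕ × ℕ → Prop, ComputablePred R ∧
    ∀ x, x ∈ A ↔ ∀ a, ∃ b, ∀ c, R (x, a, b, c)

/-- `A` is `Π⁰₃`-complete: it is `Π⁰₃`, and every `Π⁰₃` set is many-one reducible to it. -/
def IsPi03Complete (A : Set ℕ) : Prop :=
  IsPi03 A ∧ ∀ B : Set ℕ, IsPi03 B → ManyOneReducible (fun x => x ∈ B) (fun x => x ∈ A)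

/-! ### Light and dark equivalence relations -/

/-- An equivalence relation is light if there is an infinite c.e. set of pairwise inequivalent
elements. -/
def IsLight {α : Type*} [Primcodable α] (E : Setoid α) : Prop :=
  ∃ W : Set α, REPred (fun a => a ∈ W) ∧ W.Infinite ∧ ∀ a ∈ W, ∀ b ∈ W, a ≠ b → ¬ E.r a b

/-- An equivalence relation is dark if it has infinitely many classes and is not light. -/
def IsDark {α : Type*} [Primcodable α] (E : Setoid α) : Prop :=
  Infinite (Quotient E) ∧ ¬ IsLight E

/-! ### Finitely generated presentations of (associative, unital) rings -/

/-- The monomial `x_{i₁} ⋯ x_{iₖ}` in the noncommutative polynomial ring `K⟨x₀, …, xₙ₋₁⟩`. -/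
noncomputable def monomial (K : Type*) [CommRing K] {n : ℕ} (l : List (Fin n)) :
    FreeAlgebra K (Fin n) :=
  (l.map (FreeAlgebra.ι K)).prod

/-- Ring words in the generators `x₀, …, xₙ₋₁`: formal expressions `c₁ m₁ + ⋯ + cᵣ mᵣ` with integer
coefficients `cⱼ` and monomials `mⱼ`.  A word is an expression: distinct words can have the same
value in the free ring. -/
abbrev Word (n : ℕ) : Type := List (ℤ × List (Fin n))

/-- The value of a word in the free ring `ℤ⟨x₀, …, xₙ₋₁⟩`. -/
noncomputable def Word.eval {n : ℕ} (w : Word n) : FreeAlgebra ℤ (Fin n) :=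
  (w.map fun t => t.1 • monomial ℤ t.2).sum

/-- The two-sided ideal of the free ring generated by the relators. -/
noncomputable def relatorIdeal {n : ℕ} (R : Set (Word n)) :
    TwoSidedIdeal (FreeAlgebra ℤ (Fin n)) :=
  TwoSidedIdeal.span (Word.eval '' R)

/-- The ring `⟨x₀, …, xₙ₋₁ ∣ r = 0 (r ∈ R)⟩`. -/
abbrev PresentedRing {n : ℕ} (R : Set (Word n)) : Type :=
  (relatorIdeal R).ringCon.Quotient

/-- The word problem of a presentation: two words are equivalent if they have the same value in
the presented ring. -/
noncomputable def wordProblem {n : ℕ} (R : Set (Word n)) : Setoid (Word n) :=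
  Setoid.ker fun w : Word n => (relatorIdeal R).ringCon.mk' w.eval

/-! ### Indices

A natural number `i` codes a pair of a number `gens i` of generators and a program `prog i`, and
every such pair has a code. -/

/-- The number of generators of the presentation with index `i`. -/
def gens (i : ℕ) : ℕ := (Denumerable.ofNat (ℕ × Code) i).1

/-- The program that describes the relators of the presentation with index `i`. -/
def prog (i : ℕ) : Code := (Denumerable.ofNat (ℕ × Code) i).2

/-- The relators of the c.e. presentation with index `i`: the words on which the program halts. -/
def ceRelators (i : ℕ) : Set (Word (gens i)) :=
  {w | ((prog i).eval (Encodable.encode w)).Dom}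

/-- `i` is an index of a computable presentation: the program decides a set of words. -/
def IsComputableIndex (i : ℕ) : Prop :=
  ∀ w : Word (gens i),
    0 ∈ (prog i).eval (Encodable.encode w) ∨ 1 ∈ (prog i).eval (Encodable.encode w)

/-- The relators of the computable presentation with index `i`: the words that the program
accepts. -/
def computableRelators (i : ℕ) : Set (Word (gens i)) :=
  {w | 1 ∈ (prog i).eval (Encodable.encode w)}

/-- The indices of the finitely generated computable ring presentations with dark word problem. -/
def darkComputableIndices : Set ℕ :=
  {i | IsComputableIndex i ∧ IsDark (wordProblem (computableRelators i))}

/-- The indices of the finitely generated c.e. ring presentations with dark word problem. -/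
def darkCEIndices : Set ℕ :=
  {i | IsDark (wordProblem (ceRelators i))}

/-! ### Homogeneous ideals and the Golod–Shafarevich condition -/

/-- The homogeneous polynomials of degree `k`, and `0`, in `(ℤ/pℤ)⟨x, y⟩`. -/
noncomputable def homogeneousPart (p k : ℕ) :
    Submodule (ZMod p) (FreeAlgebra (ZMod p) (Fin 2)) :=
  Submodule.span (ZMod p) {f | ∃ l : List (Fin 2), l.length = k ∧ f = monomial (ZMod p) l}

/-- The number of (nonzero) homogeneous polynomials of degree `k` in `H`. -/
noncomputable def countDegree {p : ℕ} (H : Set (FreeAlgebra (ZMod p) (Fin 2))) (k : ℕ) : ℕ :=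
  Set.ncard {f | f ∈ H ∧ f ≠ 0 ∧ f ∈ homogeneousPart p k}

/-- Every element of `H` is a homogeneous polynomial. -/
def IsHomogeneousSet {p : ℕ} (H : Set (FreeAlgebra (ZMod p) (Fin 2))) : Prop :=
  ∀ f ∈ H, ∃ k, f ∈ homogeneousPart p k

/-- The Golod–Shafarevich condition on a set of homogeneous polynomials. -/
def GolodShafarevich {p : ℕ} (H : Set (FreeAlgebra (ZMod p) (Fin 2))) : Prop :=
  ∃ ε : ℝ, 0 < ε ∧ ε ≤ 1 ∧ countDegree H 0 = 0 ∧ countDegree H 1 = 0 ∧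
    ∀ k, 2 ≤ k → (countDegree H k : ℝ) ≤ ε ^ 2 * (2 - 2 * ε) ^ (k - 2)

/-- `A` is isomorphic to a quotient of `(ℤ/pℤ)⟨x, y⟩` by the ideal generated by a set of
homogeneous polynomials that satisfies the Golod–Shafarevich condition. -/
def IsGolodShafarevichRing (p : ℕ) (A : Type) [Ring A] : Prop :=
  ∃ H : Set (FreeAlgebra (ZMod p) (Fin 2)), IsHomogeneousSet H ∧ GolodShafarevich H ∧
    Nonempty (A ≃+* (TwoSidedIdeal.span H).ringCon.Quotient)

end DarkRings

/-! Hardness. Write the given set as `∀ a, ∃ b, ∀ c, Q (i, a, b, c)` with `Q` primitive recursive.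
The ring for `i` is a quotient of `(ℤ/pℤ)⟨x, y⟩`. Requirement `e` tries to spoil the `e`-th c.e. set
of words as a witness of lightness: at most once, it takes two distinct words of that set and kills
all homogeneous components of their difference. A component of degree `k` may be nonzero modulo `p`
only if, at that stage `s`, `Allowed` holds: `k ≥ e + 30`, and every `a ≤ e` has some `b ≤ k` that
no `c ≤ s` has refuted yet. Hence there are at most `k - 29` nonzero relators of degree `k`, and the
Golod–Shafarevich theorem (`exists_monomial_notMem_span`) leaves a nonzero monomial in every degree,
whether or not `i` is in the set.

If the `Π⁰₃` condition holds, requirement `e` is allowed in all sufficiently large degrees. An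
infinite c.e. set has two members that agree modulo `p` on the finitely many remaining monomials, so
the requirement acts and the set fails (`not_isLight_wordProblem`). If the condition fails at `a`,
the requirements below `a` act finitely often, and those from `a` on are shut out of each degree
after a stage that can be found by search. So the degree `n` part of the ideal comes from a finite
list of relators that can be found, and a surviving monomial of degree `n` can be found effectively.
Survivors of different degrees are inequivalent, which gives lightness (`isLight_wordProblem`).
Padding the relators by zero terms makes the set of relators decidable and not merely c.e.

Upper bound. The word problem of a c.e. presentation is c.e., uniformly in the index
(`wordProblem_iff_derives`). Having infinitely many classes says that no finite set of words meets
all classes; not being light says that each c.e. set of words is finite or contains two distinct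
equivalent words. Both are `∀ ∃ ∀` over a decidable matrix, and being a computable index is even `∀
∃`. -/

namespace DarkRings

open Nat.Partrec (Code)

/-! ### Monomials and coefficients in free algebras -/

section Coefficients

variable {K : Type*} [CommRing K] {n : ℕ}

@[simp]
theorem monomial_nil : monomial K ([] : List (Fin n)) = 1 := rfl

theorem monomial_append (l m : List (Fin n)) :
    monomial K (l ++ m) = monomial K l * monomial K m := by
  simp [monomial]

theorem basisFreeMonoid_ofList (l : List (Fin n)) :
    FreeAlgebra.basisFreeMonoid K (Fin n) (FreeMonoid.ofList l) = monomial K l := by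
  simp [FreeAlgebra.basisFreeMonoid, FreeAlgebra.equivMonoidAlgebraFreeMonoid, monomial,
    FreeMonoid.lift_ofList]

/-- The coefficient of the monomial `l`, as a linear functional. -/
noncomputable def coeff (K : Type*) [CommRing K] {n : ℕ} (l : List (Fin n)) :
    FreeAlgebra K (Fin n) →ₗ[K] K :=
  (FreeAlgebra.basisFreeMonoid K (Fin n)).coord (FreeMonoid.ofList l)

theorem coeff_monomial (l m : List (Fin n)) :
    coeff K l (monomial K m) = if m = l then 1 else 0 := by
  classical
  rw [coeff, ← basisFreeMonoid_ofList, Module.Basis.coord_apply, Module.Basis.repr_self,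
    Finsupp.single_apply]
  simp

theorem ext_coeff {f g : FreeAlgebra K (Fin n)} (h : ∀ l, coeff K l f = coeff K l g) : f = g :=
  (FreeAlgebra.basisFreeMonoid K (Fin n)).ext_elem fun l => h (FreeMonoid.toList l)

theorem span_range_monomial :
    Submodule.span K (Set.range (monomial K : List (Fin n) → _)) = ⊤ := by
  rw [← (FreeAlgebra.basisFreeMonoid K (Fin n)).span_eq]
  congr 1
  ext f
  constructor
  · rintro ⟨l, rfl⟩
    exact ⟨FreeMonoid.ofList l, basisFreeMonoid_ofList l⟩
  · rintro ⟨l, rfl⟩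
    exact ⟨FreeMonoid.toList l, (basisFreeMonoid_ofList _).symm⟩

theorem linearIndependent_monomial [Nontrivial K] :
    LinearIndependent K (monomial K : List (Fin n) → _) := by
  have h := (FreeAlgebra.basisFreeMonoid K (Fin n)).linearIndependent.comp
    (FreeMonoid.ofList : List (Fin n) → _) FreeMonoid.ofList.injective
  convert h using 1
  ext l
  exact (basisFreeMonoid_ofList l).symm

end Coefficients

/-! ### The grading of `(ℤ/pℤ)⟨x, y⟩` -/

section Grading

variable {p : ℕ}

theorem monomial_mem_homogeneousPart (l : List (Fin 2)) :
    monomial (ZMod p) l ∈ homogeneousPart p l.length :=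
  Submodule.subset_span ⟨l, rfl, rfl⟩

theorem mul_mem_homogeneousPart {a b : ℕ} {f g : FreeAlgebra (ZMod p) (Fin 2)}
    (hf : f ∈ homogeneousPart p a) (hg : g ∈ homogeneousPart p b) :
    f * g ∈ homogeneousPart p (a + b) := by
  have h := Submodule.mul_mem_mul hf hg
  rw [homogeneousPart, homogeneousPart, Submodule.span_mul_span] at h
  refine Submodule.span_mono ?_ h
  rintro _ ⟨_, ⟨l, rfl, rfl⟩, _, ⟨m, rfl, rfl⟩, rfl⟩
  exact ⟨l ++ m, by simp, (monomial_append l m).symm⟩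

theorem monomial_mul_mul_monomial_mem {k : ℕ} {h : FreeAlgebra (ZMod p) (Fin 2)}
    (hh : h ∈ homogeneousPart p k) (l r : List (Fin 2)) :
    monomial (ZMod p) l * h * monomial (ZMod p) r ∈
      homogeneousPart p (l.length + k + r.length) :=
  mul_mem_homogeneousPart (mul_mem_homogeneousPart (monomial_mem_homogeneousPart l) hh)
    (monomial_mem_homogeneousPart r)

/-- The projection to the homogeneous part of degree `k`. -/
noncomputable def homogeneousProj (p k : ℕ) :
    FreeAlgebra (ZMod p) (Fin 2) →ₗ[ZMod p] FreeAlgebra (ZMod p) (Fin 2) :=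
  (FreeAlgebra.basisFreeMonoid (ZMod p) (Fin 2)).constr (ZMod p) fun l =>
    if (FreeMonoid.toList l).length = k then monomial (ZMod p) (FreeMonoid.toList l) else 0

theorem homogeneousProj_monomial (k : ℕ) (l : List (Fin 2)) :
    homogeneousProj p k (monomial (ZMod p) l) =
      if l.length = k then monomial (ZMod p) l else 0 := by
  rw [homogeneousProj, ← basisFreeMonoid_ofList, Module.Basis.constr_basis]
  simp only [basisFreeMonoid_ofList, FreeMonoid.toList_ofList]
  rfl

theorem homogeneousProj_of_mem {j : ℕ} (k : ℕ) {f : FreeAlgebra (ZMod p) (Fin 2)}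
    (hf : f ∈ homogeneousPart p j) :
    homogeneousProj p k f = if j = k then f else 0 := by
  induction hf using Submodule.span_induction with
  | mem f hf =>
    obtain ⟨l, rfl, rfl⟩ := hf
    exact homogeneousProj_monomial k l
  | zero => simp
  | add f g _ _ hf hg => rw [map_add, hf, hg]; split_ifs <;> simp
  | smul c f _ hf => rw [map_smul, hf]; split_ifs <;> simp

theorem eq_of_mem_homogeneousPart {j k : ℕ} {f : FreeAlgebra (ZMod p) (Fin 2)} (hf : f ≠ 0)
    (hj : f ∈ homogeneousPart p j) (hk : f ∈ homogeneousPart p k) : j = k := by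
  by_contra h
  have h1 := homogeneousProj_of_mem k hj
  rw [homogeneousProj_of_mem k hk, if_pos rfl, if_neg h] at h1
  exact hf h1

theorem homogeneousPart_eq_span_range (k : ℕ) :
    homogeneousPart p k = Submodule.span (ZMod p)
      (Set.range fun v : List.Vector (Fin 2) k => monomial (ZMod p) v.1) := by
  rw [homogeneousPart]
  congr 1
  ext f
  constructor
  · rintro ⟨l, hl, rfl⟩
    exact ⟨⟨l, hl⟩, rfl⟩
  · rintro ⟨v, rfl⟩
    exact ⟨v.1, v.2, rfl⟩

instance (k : ℕ) : Module.Finite (ZMod p) (homogeneousPart p k) := by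
  rw [homogeneousPart_eq_span_range]
  exact Module.Finite.span_of_finite _ (Set.finite_range _)

theorem finrank_homogeneousPart [Fact p.Prime] (k : ℕ) :
    Module.finrank (ZMod p) (homogeneousPart p k) = 2 ^ k := by
  rw [homogeneousPart_eq_span_range, finrank_span_eq_card]
  · rw [card_vector, Fintype.card_fin]
  · exact linearIndependent_monomial.comp _ Subtype.val_injective

/-- The degree `n` part of the two-sided ideal generated by a set of homogeneous polynomials. -/
noncomputable def idealPart (H : Set (FreeAlgebra (ZMod p) (Fin 2))) (n : ℕ) :
    Submodule (ZMod p) (FreeAlgebra (ZMod p) (Fin 2)) :=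
  Submodule.span (ZMod p) {f | ∃ l r : List (Fin 2), ∃ k, ∃ h ∈ H, h ≠ 0 ∧
    h ∈ homogeneousPart p k ∧ l.length + k + r.length = n ∧
    f = monomial (ZMod p) l * h * monomial (ZMod p) r}

variable {H : Set (FreeAlgebra (ZMod p) (Fin 2))}

theorem idealPart_le (n : ℕ) : idealPart H n ≤ homogeneousPart p n := by
  rw [idealPart, Submodule.span_le]
  rintro _ ⟨l, r, k, h, -, -, hk, rfl, rfl⟩
  exact monomial_mul_mul_monomial_mem hk l r

-- The ideal is graded because its generators are homogeneous: by bilinearity it is enough to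
-- project `l * h * r` with monomials `l` and `r`, and such a product lies in a single degree.
open scoped Pointwise in
theorem homogeneousProj_mem_idealPart (hH : IsHomogeneousSet H)
    {f : FreeAlgebra (ZMod p) (Fin 2)} (hf : f ∈ TwoSidedIdeal.span H) (n : ℕ) :
    homogeneousProj p n f ∈ idealPart H n := by
  rw [TwoSidedIdeal.mem_span_iff_mem_addSubgroup_closure] at hf
  suffices h : AddSubgroup.closure ((Set.univ : Set (FreeAlgebra (ZMod p) (Fin 2))) * H * Set.univ) ≤
      ((idealPart H n).comap (homogeneousProj p n)).toAddSubgroup from h hf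
  rw [AddSubgroup.closure_le]
  rintro _ ⟨_, ⟨a, -, h, hh, rfl⟩, b, -, rfl⟩
  change homogeneousProj p n (a * h * b) ∈ idealPart H n
  have ha : a ∈ Submodule.span (ZMod p) (Set.range (monomial (ZMod p) : List (Fin 2) → _)) :=
    span_range_monomial (K := ZMod p) ▸ Submodule.mem_top
  have hb : b ∈ Submodule.span (ZMod p) (Set.range (monomial (ZMod p) : List (Fin 2) → _)) :=
    span_range_monomial (K := ZMod p) ▸ Submodule.mem_top
  induction ha using Submodule.span_induction with
  | zero => simp
  | add f g _ _ hf hg => rw [add_mul, add_mul, map_add]; exact add_mem hf hg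
  | smul c f _ hf =>
    rw [smul_mul_assoc, smul_mul_assoc, map_smul]; exact Submodule.smul_mem _ _ hf
  | mem a ha =>
    obtain ⟨l, rfl⟩ := ha
    induction hb using Submodule.span_induction with
    | zero => simp
    | add f g _ _ hf hg => rw [mul_add, map_add]; exact add_mem hf hg
    | smul c f _ hf => rw [mul_smul_comm, map_smul]; exact Submodule.smul_mem _ _ hf
    | mem b hb =>
      obtain ⟨r, rfl⟩ := hb
      obtain ⟨k, hk⟩ := hH h hh
      rw [homogeneousProj_of_mem n (monomial_mul_mul_monomial_mem hk l r)]
      split_ifs with hn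
      · by_cases h0 : h = 0
        · simp [h0]
        · exact Submodule.subset_span ⟨l, r, k, h, hh, h0, hk, hn, rfl⟩
      · exact zero_mem _

theorem mem_idealPart_of_mem_span (hH : IsHomogeneousSet H)
    {f : FreeAlgebra (ZMod p) (Fin 2)} (hf : f ∈ TwoSidedIdeal.span H) {n : ℕ}
    (hn : f ∈ homogeneousPart p n) : f ∈ idealPart H n := by
  have := homogeneousProj_mem_idealPart hH hf n
  rwa [homogeneousProj_of_mem n hn, if_pos rfl] at this

theorem mem_span_of_mem_idealPart {n : ℕ} {f : FreeAlgebra (ZMod p) (Fin 2)}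
    (hf : f ∈ idealPart H n) : f ∈ TwoSidedIdeal.span H := by
  induction hf using Submodule.span_induction with
  | mem f hf =>
    obtain ⟨l, r, k, h, hh, -, -, -, rfl⟩ := hf
    exact TwoSidedIdeal.mul_mem_right _ _ _
      (TwoSidedIdeal.mul_mem_left _ _ _ (TwoSidedIdeal.subset_span hh))
  | zero => exact zero_mem _
  | add f g _ _ hf hg => exact add_mem hf hg
  | smul c f _ hf =>
    rw [Algebra.smul_def]
    exact TwoSidedIdeal.mul_mem_left _ _ _ hf

end Grading

/-! ### The Golod–Shafarevich theorem -/

section GolodShafarevich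

variable {p : ℕ} {H : Set (FreeAlgebra (ZMod p) (Fin 2))}

/-- Right multiplication by a generator. -/
noncomputable abbrev mulGen (p : ℕ) (x : Fin 2) :
    FreeAlgebra (ZMod p) (Fin 2) →ₗ[ZMod p] FreeAlgebra (ZMod p) (Fin 2) :=
  LinearMap.mulRight (ZMod p) (monomial (ZMod p) [x])

theorem mulGen_mem (W : Submodule (ZMod p) (FreeAlgebra (ZMod p) (Fin 2)))
    {f : FreeAlgebra (ZMod p) (Fin 2)} (hf : f ∈ W) (x : Fin 2) :
    f * monomial (ZMod p) [x] ∈ W.map (mulGen p 0) ⊔ W.map (mulGen p 1) := by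
  fin_cases x
  · exact Submodule.mem_sup_left ⟨f, hf, rfl⟩
  · exact Submodule.mem_sup_right ⟨f, hf, rfl⟩

theorem mul_monomial_mem_idealPart {m : ℕ} {u : FreeAlgebra (ZMod p) (Fin 2)}
    (hu : u ∈ idealPart H m) (l : List (Fin 2)) :
    u * monomial (ZMod p) l ∈ idealPart H (m + l.length) := by
  induction hu using Submodule.span_induction with
  | mem f hf =>
    obtain ⟨l', r, k, h, hh, h0, hk, rfl, rfl⟩ := hf
    refine Submodule.subset_span ⟨l', r ++ l, k, h, hh, h0, hk, ?_, ?_⟩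
    · simp; ring
    · rw [monomial_append, ← mul_assoc]
  | zero => simp
  | add f g _ _ hf hg => rw [add_mul]; exact add_mem hf hg
  | smul c f _ hf => rw [smul_mul_assoc]; exact Submodule.smul_mem _ _ hf

/-- Each monomial of `f` has positive degree, so its last generator can be split off on the right;
what stands before it still lies in the ideal. -/
theorem mul_mem_map_mulGen {m k : ℕ} {u f : FreeAlgebra (ZMod p) (Fin 2)}
    (hu : u ∈ idealPart H m) (hf : f ∈ homogeneousPart p (k + 1)) :
    u * f ∈ (idealPart H (m + k)).map (mulGen p 0) ⊔ (idealPart H (m + k)).map (mulGen p 1) := by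
  induction hf using Submodule.span_induction with
  | mem f hf =>
    obtain ⟨l, hl, rfl⟩ := hf
    obtain rfl | ⟨l, x, rfl⟩ := l.eq_nil_or_concat'
    · simp at hl
    · rw [monomial_append, ← mul_assoc]
      refine mulGen_mem _ ?_ x
      have : l.length = k := by simpa using hl
      exact this ▸ mul_monomial_mem_idealPart hu l
  | zero => simp
  | add f g _ _ hf hg => rw [mul_add]; exact add_mem hf hg
  | smul c f _ hf => rw [mul_smul_comm]; exact Submodule.smul_mem _ _ hf

/-- By the modular law, an arbitrary linear complement cut down to degree `n` is a complement inside
degree `n`. -/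
theorem exists_complement_idealPart [Fact p.Prime]
    (H : Set (FreeAlgebra (ZMod p) (Fin 2))) (n : ℕ) :
    ∃ B : Submodule (ZMod p) (FreeAlgebra (ZMod p) (Fin 2)), B ≤ homogeneousPart p n ∧
      idealPart H n ⊔ B = homogeneousPart p n ∧
      Module.finrank (ZMod p) (idealPart H n) + Module.finrank (ZMod p) B = 2 ^ n := by
  obtain ⟨C, hC⟩ := exists_isCompl (idealPart H n)
  have h1 : idealPart H n ⊔ C ⊓ homogeneousPart p n = homogeneousPart p n := by
    rw [← sup_inf_assoc_of_le _ (idealPart_le n), hC.sup_eq_top, top_inf_eq]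
  have h2 : idealPart H n ⊓ (C ⊓ homogeneousPart p n) = ⊥ := by
    rw [← inf_assoc, hC.inf_eq_bot, bot_inf_eq]
  refine ⟨C ⊓ homogeneousPart p n, inf_le_right, h1, ?_⟩
  have : Module.Finite (ZMod p) (idealPart H n) :=
    Submodule.finiteDimensional_of_le (idealPart_le n)
  have : Module.Finite (ZMod p) ↥(C ⊓ homogeneousPart p n) :=
    Submodule.finiteDimensional_of_le inf_le_right
  have h3 := Submodule.finrank_sup_add_finrank_inf_eq (idealPart H n) (C ⊓ homogeneousPart p n)
  rw [h1, h2, finrank_bot, finrank_homogeneousPart] at h3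
  omega

theorem finrank_finset_sup_map_le {K V W ι : Type*} [Field K] [AddCommGroup V] [Module K V]
    [AddCommGroup W] [Module K W] (B : ι → Submodule K V) [∀ i, Module.Finite K (B i)]
    (f : ι → V →ₗ[K] W) (s : Finset ι) :
    Module.finrank K ↥(s.sup fun i => (B i).map (f i)) ≤ ∑ i ∈ s, Module.finrank K (B i) := by
  classical
  induction s using Finset.induction_on with
  | empty => simp
  | insert a s ha ih =>
    rw [Finset.sup_insert, Finset.sum_insert ha]
    refine (Submodule.finrank_add_le_finrank_add_finrank _ _).trans ?_
    gcongr
    exact Submodule.finrank_map_le _ _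

/-- A product `l * h * r` with `r` nonempty comes from degree `n` by a right multiplication. If `r`
is empty, split `l` along `hB`: the ideal part of `l` gives again something from degree `n`, because
`h` has positive degree. So a relator need only be multiplied by the complements `B`, which keeps
the dimension count small. -/
theorem idealPart_succ_le (h0 : ∀ h ∈ H, h ∈ homogeneousPart p 0 → h = 0)
    (B : ℕ → Submodule (ZMod p) (FreeAlgebra (ZMod p) (Fin 2)))
    (hB : ∀ n, idealPart H n ⊔ B n = homogeneousPart p n)
    (G : ℕ → Finset (FreeAlgebra (ZMod p) (Fin 2)))
    (hG : ∀ k, ∀ h ∈ H, h ≠ 0 → h ∈ homogeneousPart p k → h ∈ G k) (n : ℕ) :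
    idealPart H (n + 1) ≤
      ((idealPart H n).map (mulGen p 0) ⊔ (idealPart H n).map (mulGen p 1)) ⊔
        ((Finset.range (n + 2)).sigma fun k => G k).sup
          fun q => (B (n + 1 - q.1)).map (LinearMap.mulRight (ZMod p) q.2) := by
  conv_lhs => rw [idealPart]
  rw [Submodule.span_le]
  rintro _ ⟨l, r, k, h, hh, hne, hk, hn, rfl⟩
  obtain rfl | ⟨r, x, rfl⟩ := r.eq_nil_or_concat'
  · simp only [List.length_nil, add_zero] at hn
    rw [monomial_nil, mul_one]
    obtain ⟨u, hu, b, hb, hub⟩ : ∃ u ∈ idealPart H l.length, ∃ b ∈ B l.length,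
        u + b = monomial (ZMod p) l := by
      rw [← Submodule.mem_sup, hB]
      exact monomial_mem_homogeneousPart l
    rw [← hub, add_mul]
    refine add_mem ?_ ?_
    · obtain _ | k := k
      · exact absurd (h0 h hh hk) hne
      · refine Submodule.mem_sup_left ?_
        have := mul_mem_map_mulGen hu hk
        rwa [show l.length + k = n by omega] at this
    · refine Submodule.mem_sup_right ?_
      have hmem : (⟨k, h⟩ : Σ _ : ℕ, FreeAlgebra (ZMod p) (Fin 2)) ∈
          (Finset.range (n + 2)).sigma fun k => G k := by
        rw [Finset.mem_sigma, Finset.mem_range]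
        exact ⟨by dsimp only; omega, hG k h hh hne hk⟩
      refine Finset.le_sup (f := fun q : Σ _ : ℕ, FreeAlgebra (ZMod p) (Fin 2) =>
        (B (n + 1 - q.1)).map (LinearMap.mulRight (ZMod p) q.2)) hmem ?_
      rw [← show n + 1 - k = l.length by omega] at hb
      exact Submodule.mem_map_of_mem (f := LinearMap.mulRight (ZMod p) h) hb
  · refine Submodule.mem_sup_left ?_
    rw [monomial_append, ← mul_assoc]
    refine mulGen_mem (idealPart H n) (Submodule.subset_span ⟨l, r, k, h, hh, hne, hk, ?_, rfl⟩) x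
    simp at hn
    omega

/-- The convolution `S` of `b` with the geometric bound satisfies a one-step recursion. The estimate
`S n ≤ ε * b n` propagates along it since `ε ^ 2 + (2 - 2 * ε) * ε = ε * (2 - ε)`. -/
theorem golodShafarevich_growth {ε : ℝ} (h0 : 0 < ε) (h1 : ε ≤ 1) {r b : ℕ → ℝ}
    (hr0 : r 0 = 0) (hr1 : r 1 = 0) (hr : ∀ k, r (k + 2) ≤ ε ^ 2 * (2 - 2 * ε) ^ k)
    (hb : ∀ n, 0 ≤ b n)
    (hrec : ∀ n, 2 * b n ≤ b (n + 1) + ∑ k ∈ Finset.range (n + 2), r k * b (n + 1 - k)) (n : ℕ) :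
    (2 - ε) * b n ≤ b (n + 1) := by
  set S : ℕ → ℝ := fun n => ∑ k ∈ Finset.range n, ε ^ 2 * (2 - 2 * ε) ^ k * b (n - 1 - k)
  have hS : ∀ n, S (n + 1) = ε ^ 2 * b n + (2 - 2 * ε) * S n := by
    intro n
    simp only [S]
    rw [Finset.sum_range_succ', Finset.mul_sum, add_comm]
    congr 1
    · simp
    · refine Finset.sum_congr rfl fun k hk => ?_
      rw [show n + 1 - 1 - (k + 1) = n - 1 - k by omega]
      ring
  have hstep : ∀ n, 2 * b n ≤ b (n + 1) + S n := by
    intro n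
    refine (hrec n).trans ?_
    rw [Finset.sum_range_succ', Finset.sum_range_succ', hr0]
    simp only [zero_add, hr1, zero_mul, add_zero, S]
    refine add_le_add le_rfl (Finset.sum_le_sum fun k _ => ?_)
    rw [show n + 1 - (k + 1 + 1) = n - 1 - k by omega]
    exact mul_le_mul_of_nonneg_right (hr k) (hb _)
  have hSb : ∀ n, S n ≤ ε * b n := by
    intro n
    induction n with
    | zero => simpa [S] using mul_nonneg h0.le (hb 0)
    | succ n ih =>
      rw [hS]
      have h2 : (2 - 2 * ε) * S n ≤ (2 - 2 * ε) * (ε * b n) :=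
        mul_le_mul_of_nonneg_left ih (by linarith)
      have h3 : ε * ((2 - ε) * b n) ≤ ε * b (n + 1) :=
        mul_le_mul_of_nonneg_left (by linarith [hstep n]) h0.le
      linarith
  linarith [hstep n, hSb n]

/-- **Golod–Shafarevich theorem**: the quotient by a set of homogeneous polynomials that satisfies
the Golod–Shafarevich condition is nonzero in every degree. -/
theorem exists_monomial_notMem_span [Fact p.Prime] (hH : IsHomogeneousSet H)
    (hGS : GolodShafarevich H) (n : ℕ) :
    ∃ l : List (Fin 2), l.length = n ∧ monomial (ZMod p) l ∉ TwoSidedIdeal.span H := by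
  obtain ⟨ε, hε0, hε1, hc0, hc1, hc⟩ := hGS
  have hfin : ∀ k, {f | f ∈ H ∧ f ≠ 0 ∧ f ∈ homogeneousPart p k}.Finite := fun k => by
    have : Finite (homogeneousPart p k) := Module.finite_of_finite (ZMod p)
    exact (Set.toFinite (homogeneousPart p k : Set _)).subset fun f hf => hf.2.2
  choose B hBle hBsup hBrank using exists_complement_idealPart H
  have hcard : ∀ k, (hfin k).toFinset.card = countDegree H k := fun k => by
    rw [countDegree, Set.ncard_eq_toFinset_card _ (hfin k)]
  have hfinB : ∀ n, Module.Finite (ZMod p) (B n) := fun n =>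
    Submodule.finiteDimensional_of_le (hBle n)
  have hfinI : ∀ n, Module.Finite (ZMod p) (idealPart H n) := fun n =>
    Submodule.finiteDimensional_of_le (idealPart_le n)
  have h0 : ∀ h ∈ H, h ∈ homogeneousPart p 0 → h = 0 := by
    intro h hh hk
    by_contra hne
    have hm : h ∈ (hfin 0).toFinset := (hfin 0).mem_toFinset.2 ⟨hh, hne, hk⟩
    rw [Finset.card_eq_zero.1 ((hcard 0).trans hc0)] at hm
    simp at hm
  have hrec : ∀ n, 2 * Module.finrank (ZMod p) (B n) ≤ Module.finrank (ZMod p) (B (n + 1)) +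
      ∑ k ∈ Finset.range (n + 2), countDegree H k * Module.finrank (ZMod p) (B (n + 1 - k)) := by
    intro n
    have hle := idealPart_succ_le h0 B hBsup (fun k => (hfin k).toFinset)
      (fun k h hh hne hk => (hfin k).mem_toFinset.2 ⟨hh, hne, hk⟩) n
    have h1 := (Submodule.finrank_mono hle).trans
      ((Submodule.finrank_add_le_finrank_add_finrank _ _).trans (add_le_add
        ((Submodule.finrank_add_le_finrank_add_finrank _ _).trans (add_le_add
          (Submodule.finrank_map_le _ _) (Submodule.finrank_map_le _ _)))
        (finrank_finset_sup_map_le _ _ _)))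
    have hsum : (∑ q ∈ (Finset.range (n + 2)).sigma fun k => (hfin k).toFinset,
        Module.finrank (ZMod p) (B (n + 1 - q.1))) = ∑ k ∈ Finset.range (n + 2),
          countDegree H k * Module.finrank (ZMod p) (B (n + 1 - k)) := by
      rw [Finset.sum_sigma]
      refine Finset.sum_congr rfl fun k _ => ?_
      rw [← hcard]
      exact Finset.sum_const_nat fun _ _ => rfl
    rw [hsum] at h1
    -- Replacing the dimension of each ideal part by `2 ^ m` minus that of the complement reverses
    -- the inequality and cancels the powers of two.
    have h2 := hBrank n
    have h3 := hBrank (n + 1)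
    rw [pow_succ] at h3
    omega
  have hgrow := golodShafarevich_growth (r := fun k => (countDegree H k : ℝ))
    (b := fun n => (Module.finrank (ZMod p) (B n) : ℝ)) hε0 hε1 (by simp [hc0]) (by simp [hc1])
    (fun k => by simpa using hc (k + 2) (by omega)) (fun n => by positivity)
    (fun n => by exact_mod_cast hrec n)
  have hI0 : idealPart H 0 = ⊥ := by
    rw [idealPart, Submodule.span_eq_bot]
    rintro _ ⟨l, r, k, h, hh, hne, hk, hn, rfl⟩
    obtain rfl : k = 0 := by omega
    exact absurd (h0 h hh hk) hne
  have hpos : ∀ n, 0 < Module.finrank (ZMod p) (B n) := by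
    intro n
    induction n with
    | zero =>
      have := hBrank 0
      rw [hI0, finrank_bot] at this
      omega
    | succ n ih =>
      have h1 := hgrow n
      have h2 : (0 : ℝ) < Module.finrank (ZMod p) (B n) := by exact_mod_cast ih
      have h3 : (0 : ℝ) < Module.finrank (ZMod p) (B (n + 1)) :=
        lt_of_lt_of_le (mul_pos (by linarith) h2) h1
      exact_mod_cast h3
  by_contra! hall
  have hle : homogeneousPart p n ≤ idealPart H n := by
    rw [homogeneousPart, Submodule.span_le]
    rintro _ ⟨l, hl, rfl⟩
    exact mem_idealPart_of_mem_span hH (hall l hl) (hl ▸ monomial_mem_homogeneousPart l)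
  have h1 := Submodule.finrank_mono hle
  rw [finrank_homogeneousPart] at h1
  have h2 := hBrank n
  have h3 := hpos n
  omega

end GolodShafarevich

/-! ### Values of words -/

namespace Word

variable {n : ℕ}

/-- The value of a word in the free algebra over `K`. -/
noncomputable def evalIn (K : Type*) [CommRing K] (w : Word n) : FreeAlgebra K (Fin n) :=
  (w.map fun t => (t.1 : K) • monomial K t.2).sum

/-- The coefficient of a monomial in a word. -/
def coeffAt {X : Type*} [DecidableEq X] (w : List (ℤ × List X)) (l : List X) : ℤ :=
  (w.map fun t => if t.2 = l then t.1 else 0).sum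

/-- The difference of two words. -/
def diff {X : Type*} (w₁ w₂ : List (ℤ × List X)) : List (ℤ × List X) :=
  w₁ ++ w₂.map fun t => (-t.1, t.2)

/-- The homogeneous component of degree `k` of a word. -/
def component (k : ℕ) (w : Word n) : Word n := w.filter fun t => t.2.length = k

variable (K : Type*) [CommRing K]

@[simp]
theorem evalIn_nil : evalIn K ([] : Word n) = 0 := rfl

@[simp]
theorem evalIn_cons (t : ℤ × List (Fin n)) (w : Word n) :
    evalIn K (t :: w) = (t.1 : K) • monomial K t.2 + evalIn K w := by
  simp [evalIn]

@[simp]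
theorem evalIn_append (w₁ w₂ : Word n) :
    evalIn K (w₁ ++ w₂ : Word n) = evalIn K w₁ + evalIn K w₂ := by
  simp [evalIn]

theorem evalIn_replicate_zero (m : ℕ) :
    evalIn K (List.replicate m (0, []) : Word n) = 0 := by
  induction m with
  | zero => rfl
  | succ m ih => rw [List.replicate_succ, evalIn_cons, ih]; simp

theorem eval_eq_evalIn (w : Word n) : w.eval = evalIn ℤ w := by
  simp [eval, evalIn, Algebra.smul_def]

theorem evalIn_diff (w₁ w₂ : Word n) : evalIn K (diff w₁ w₂) = evalIn K w₁ - evalIn K w₂ := by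
  rw [diff, evalIn_append, sub_eq_add_neg]
  congr 1
  induction w₂ with
  | nil => simp
  | cons t w ih => rw [List.map_cons, evalIn_cons, evalIn_cons, ih]; simp; abel

theorem coeff_evalIn (w : Word n) (l : List (Fin n)) :
    coeff K l (evalIn K w) = (coeffAt w l : K) := by
  induction w with
  | nil => simp [coeffAt]
  | cons t w ih =>
    rw [evalIn_cons, map_add, ih, map_smul, coeff_monomial]
    simp only [coeffAt, List.map_cons, List.sum_cons, Int.cast_add]
    congr 1
    split_ifs <;> simp

theorem coeffAt_eq_zero {X : Type*} [DecidableEq X] {w : List (ℤ × List X)} {l : List X}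
    (h : ∀ t ∈ w, t.2 ≠ l) :
    coeffAt w l = 0 := by
  rw [coeffAt]
  refine List.sum_eq_zero fun x hx => ?_
  obtain ⟨t, ht, rfl⟩ := List.mem_map.1 hx
  exact if_neg (h t ht)

theorem coeffAt_component (k : ℕ) (w : Word n) (l : List (Fin n)) :
    coeffAt (component k w) l = if l.length = k then coeffAt w l else 0 := by
  induction w with
  | nil => simp [component, coeffAt]
  | cons t w ih =>
    simp only [component, coeffAt, List.filter_cons, List.map_cons, List.sum_cons] at ih ⊢
    by_cases ht : t.2.length = k <;> by_cases hl : l.length = k <;> by_cases h : t.2 = l <;>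
      simp_all

theorem sum_evalIn_component (w : Word n) {N : ℕ} (hN : ∀ t ∈ w, t.2.length < N) :
    ∑ k ∈ Finset.range N, evalIn K (component k w) = evalIn K w := by
  induction w with
  | nil => simp [component]
  | cons t w ih =>
    have h : ∀ k, evalIn K (component k (t :: w)) =
        (if t.2.length = k then (t.1 : K) • monomial K t.2 else 0) +
          evalIn K (component k w) := by
      intro k
      by_cases hk : t.2.length = k <;> simp [component, hk]
    simp only [h]
    rw [Finset.sum_add_distrib, ih fun t ht => hN t (List.mem_cons_of_mem _ ht), evalIn_cons,
      Finset.sum_ite_eq, if_pos (Finset.mem_range.2 (hN t List.mem_cons_self))]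

theorem evalIn_component_mem {p : ℕ} (k : ℕ) (w : Word 2) :
    evalIn (ZMod p) (component k w) ∈ homogeneousPart p k := by
  refine list_sum_mem fun f hf => ?_
  obtain ⟨t, ht, rfl⟩ := List.mem_map.1 hf
  have hk : t.2.length = k := by simpa using (List.mem_filter.1 ht).2
  exact Submodule.smul_mem _ _ (hk ▸ monomial_mem_homogeneousPart t.2)

end Word

/-! ### Presentations of algebras over `ℤ/pℤ` -/

section Reduction

variable {n : ℕ} (p : ℕ)

/-- Reduction modulo `p`. -/
noncomputable def reduction : FreeAlgebra ℤ (Fin n) →+* FreeAlgebra (ZMod p) (Fin n) :=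
  (FreeAlgebra.lift ℤ (FreeAlgebra.ι (ZMod p))).toRingHom

theorem reduction_monomial (l : List (Fin n)) :
    reduction p (monomial ℤ l) = monomial (ZMod p) l := by
  simp only [reduction, monomial, AlgHom.toRingHom_eq_coe, RingHom.coe_coe, map_list_prod,
    List.map_map]
  congr 2
  ext x
  simp

theorem reduction_algebraMap_mul (c : ℤ) (f : FreeAlgebra ℤ (Fin n)) :
    reduction p (algebraMap ℤ _ c * f) = (c : ZMod p) • reduction p f := by
  rw [Algebra.smul_def, map_mul, eq_intCast, map_intCast, map_intCast]

theorem reduction_evalIn (w : Word n) : reduction p (w.evalIn ℤ) = w.evalIn (ZMod p) := by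
  induction w with
  | nil => simp
  | cons t w ih =>
    rw [Word.evalIn_cons, Word.evalIn_cons, map_add, ih, Int.cast_id,
      Algebra.smul_def t.1, reduction_algebraMap_mul,
      reduction_monomial]

theorem coeff_reduction (f : FreeAlgebra ℤ (Fin n)) (l : List (Fin n)) :
    coeff (ZMod p) l (reduction p f) = (coeff ℤ l f : ZMod p) := by
  have hf : f ∈ Submodule.span ℤ (Set.range (monomial ℤ : List (Fin n) → _)) :=
    span_range_monomial (K := ℤ) ▸ Submodule.mem_top
  induction hf using Submodule.span_induction with
  | mem f hf =>
    obtain ⟨m, rfl⟩ := hf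
    rw [reduction_monomial, coeff_monomial, coeff_monomial]
    split_ifs <;> simp
  | zero => simp
  | add f g _ _ hf hg => simp only [map_add, hf, hg, Int.cast_add]
  | smul c f _ hf =>
    rw [map_zsmul, map_zsmul, map_zsmul, hf]
    simp

theorem reduction_surjective : Function.Surjective (reduction p (n := n)) := by
  intro f
  have hf : f ∈ Submodule.span (ZMod p) (Set.range (monomial (ZMod p) : List (Fin n) → _)) :=
    span_range_monomial (K := ZMod p) ▸ Submodule.mem_top
  induction hf using Submodule.span_induction with
  | mem f hf =>
    obtain ⟨m, rfl⟩ := hf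
    exact ⟨_, reduction_monomial p m⟩
  | zero => exact ⟨0, map_zero _⟩
  | add f g _ _ hf hg =>
    obtain ⟨f, rfl⟩ := hf
    obtain ⟨g, rfl⟩ := hg
    exact ⟨f + g, map_add _ _ _⟩
  | smul c f _ hf =>
    obtain ⟨f, rfl⟩ := hf
    obtain ⟨c, rfl⟩ := ZMod.intCast_surjective c
    exact ⟨_, reduction_algebraMap_mul p c f⟩

/-- All coefficients of an element of the kernel are divisible by `p`. -/
theorem mem_of_reduction_eq_zero {I : TwoSidedIdeal (FreeAlgebra ℤ (Fin n))}
    (hI : (p : FreeAlgebra ℤ (Fin n)) ∈ I) {f : FreeAlgebra ℤ (Fin n)}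
    (hf : reduction p f = 0) : f ∈ I := by
  have hc : ∀ l, (p : ℤ) ∣ coeff ℤ l f := by
    intro l
    rw [← ZMod.intCast_zmod_eq_zero_iff_dvd, ← coeff_reduction, hf, map_zero]
  rw [← (FreeAlgebra.basisFreeMonoid ℤ (Fin n)).linearCombination_repr f,
    Finsupp.linearCombination_apply]
  refine sum_mem fun l _ => ?_
  obtain ⟨c, hc⟩ := hc (FreeMonoid.toList l)
  have hc' : (FreeAlgebra.basisFreeMonoid ℤ (Fin n)).repr f l = p * c := hc
  dsimp only
  rw [hc', Algebra.smul_def, map_mul, map_natCast, mul_assoc]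
  exact TwoSidedIdeal.mul_mem_right _ _ _ hI

variable {p} {R : Set (Word n)}

-- The relator `p` absorbs the kernel of reduction, so it suffices to lift members of the ideal
-- modulo `p`; the factors around a relator lift because reduction is surjective.
open scoped Pointwise in
theorem mem_relatorIdeal_iff (hp : [((p : ℤ), [])] ∈ R) {f : FreeAlgebra ℤ (Fin n)} :
    f ∈ relatorIdeal R ↔
      reduction p f ∈ TwoSidedIdeal.span (Word.evalIn (ZMod p) '' R) := by
  constructor
  · intro hf
    have : relatorIdeal R ≤
        (TwoSidedIdeal.span (Word.evalIn (ZMod p) '' R)).comap (reduction p) := by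
      rw [relatorIdeal, TwoSidedIdeal.span_le]
      rintro _ ⟨w, hw, rfl⟩
      rw [SetLike.mem_coe, TwoSidedIdeal.mem_comap, Word.eval_eq_evalIn, reduction_evalIn]
      exact TwoSidedIdeal.subset_span ⟨w, hw, rfl⟩
    exact (TwoSidedIdeal.mem_comap _).1 (this hf)
  · intro hf
    have hpI : (p : FreeAlgebra ℤ (Fin n)) ∈ relatorIdeal R := by
      refine TwoSidedIdeal.subset_span ⟨_, hp, ?_⟩
      simp [Word.eval]
    suffices h : ∀ g ∈ TwoSidedIdeal.span (Word.evalIn (ZMod p) '' R),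
        ∃ f ∈ relatorIdeal R, reduction p f = g by
      obtain ⟨f', hf', h'⟩ := h _ hf
      have := mem_of_reduction_eq_zero p hpI (f := f - f') (by rw [map_sub, h', sub_self])
      simpa using add_mem this hf'
    intro g hg
    rw [TwoSidedIdeal.mem_span_iff_mem_addSubgroup_closure] at hg
    induction hg using AddSubgroup.closure_induction with
    | mem g hg =>
      obtain ⟨_, ⟨a, -, _, ⟨w, hw, rfl⟩, rfl⟩, b, -, rfl⟩ := hg
      obtain ⟨a, rfl⟩ := reduction_surjective p a
      obtain ⟨b, rfl⟩ := reduction_surjective p b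
      refine ⟨a * w.eval * b, TwoSidedIdeal.mul_mem_right _ _ _ (TwoSidedIdeal.mul_mem_left _ _ _
        (TwoSidedIdeal.subset_span ⟨w, hw, rfl⟩)), ?_⟩
      rw [map_mul, map_mul, Word.eval_eq_evalIn, reduction_evalIn]
    | zero => exact ⟨0, zero_mem _, map_zero _⟩
    | add f g _ _ hf hg =>
      obtain ⟨f, hf, rfl⟩ := hf
      obtain ⟨g, hg, rfl⟩ := hg
      exact ⟨f + g, add_mem hf hg, map_add _ _ _⟩
    | neg f _ hf =>
      obtain ⟨f, hf, rfl⟩ := hf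
      exact ⟨-f, neg_mem hf, map_neg _ _⟩

theorem nonempty_presentedRing_ringEquiv (hp : [((p : ℤ), [])] ∈ R) :
    Nonempty (PresentedRing R ≃+*
      (TwoSidedIdeal.span (Word.evalIn (ZMod p) '' R)).ringCon.Quotient) := by
  set J := TwoSidedIdeal.span (Word.evalIn (ZMod p) '' R)
  have hker : (relatorIdeal R).ringCon =
      RingCon.ker (J.ringCon.mk'.comp (reduction p (n := n))) := by
    ext x y
    rw [TwoSidedIdeal.rel_iff, mem_relatorIdeal_iff hp, map_sub, ← TwoSidedIdeal.rel_iff]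
    exact Quotient.eq''.symm
  exact ⟨RingEquiv.ofBijective (RingCon.lift _ _ hker.le) (RingCon.lift_bijective_iff.2
    ⟨hker, J.ringCon.mk'_surjective.comp (reduction_surjective p)⟩)⟩

theorem wordProblem_iff (hp : [((p : ℤ), [])] ∈ R) (w₁ w₂ : Word n) :
    (wordProblem R).r w₁ w₂ ↔ Word.evalIn (ZMod p) (Word.diff w₁ w₂) ∈
      TwoSidedIdeal.span (Word.evalIn (ZMod p) '' R) := by
  rw [Word.evalIn_diff, ← reduction_evalIn, ← reduction_evalIn, ← map_sub,
    ← mem_relatorIdeal_iff hp, ← TwoSidedIdeal.rel_iff, ← Word.eval_eq_evalIn,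
    ← Word.eval_eq_evalIn]
  exact Quotient.eq''

end Reduction

/-! ### Primitive recursive predicates -/

section Primrec

variable {α β : Type*} [Primcodable α] [Primcodable β]

theorem primrecPred_forall_lt {f : α → ℕ} {R : α → ℕ → Prop} (hf : Primrec f)
    (hR : PrimrecPred fun q : α × ℕ => R q.1 q.2) : PrimrecPred fun a => ∀ x < f a, R a x :=
  (PrimrecRel.forall_mem_list (R := fun x a => R a x)
    (hR.comp (Primrec.snd.pair Primrec.fst))).comp (Primrec.list_range.comp hf) Primrec.id
    |>.of_eq fun a => by simp

theorem primrecPred_exists_lt {f : α → ℕ} {R : α → ℕ → Prop} (hf : Primrec f)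
    (hR : PrimrecPred fun q : α × ℕ => R q.1 q.2) : PrimrecPred fun a => ∃ x < f a, R a x :=
  (PrimrecRel.exists_mem_list (R := fun x a => R a x)
    (hR.comp (Primrec.snd.pair Primrec.fst))).comp (Primrec.list_range.comp hf) Primrec.id
    |>.of_eq fun a => by simp

theorem primrecPred_forall_mem {f : α → List β} {R : α → β → Prop} (hf : Primrec f)
    (hR : PrimrecPred fun q : α × β => R q.1 q.2) : PrimrecPred fun a => ∀ x ∈ f a, R a x :=
  (PrimrecRel.forall_mem_list (R := fun x a => R a x)
    (hR.comp (Primrec.snd.pair Primrec.fst))).comp hf Primrec.id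

theorem primrecPred_imp {P Q : α → Prop} (hP : PrimrecPred P) (hQ : PrimrecPred Q) :
    PrimrecPred fun a => P a → Q a :=
  (hP.not.or hQ).of_eq fun a => by tauto

theorem primrec_listFilter {f : α → List β} {R : α → β → Prop}
    [∀ a, DecidablePred (R a)] (hf : Primrec f)
    (hR : PrimrecPred fun q : α × β => R q.1 q.2) :
    Primrec fun a => (f a).filter fun b => R a b := by
  have hR' : PrimrecRel fun (b : β) (a : α) => R a b := hR.comp (Primrec.snd.pair Primrec.fst)
  exact (hR'.listFilter.comp hf Primrec.id).of_eq fun a => rfl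

theorem primrec_list_replicate {f : α → ℕ} (b : β) (hf : Primrec f) :
    Primrec fun a => List.replicate (f a) b :=
  (Primrec.list_map (Primrec.list_range.comp hf) (Primrec.const b).to₂).of_eq fun a => by
    simp [List.map_const']

/-- Integer arithmetic rests on the coding of `n` by `2 * n` and of `-(n + 1)` by `2 * n + 1`,
together with the splitting of an integer into its positive and negative parts. -/
theorem primrec_intCast : Primrec fun n : ℕ => (n : ℤ) :=
  Primrec.encode_iff.1 <| Primrec.nat_double.of_eq fun n => by
    rfl

theorem primrec_negSucc : Primrec Int.negSucc :=
  Primrec.encode_iff.1 <| Primrec.nat_double_succ.of_eq fun n => by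
    rfl

theorem primrec_toNat : Primrec Int.toNat :=
  (Primrec.ite (c := fun z : ℤ => Encodable.encode z % 2 = 0)
    (Primrec.eq.comp (Primrec.nat_mod.comp Primrec.encode (Primrec.const 2)) (Primrec.const 0))
    (Primrec.nat_div.comp Primrec.encode (Primrec.const 2)) (Primrec.const 0)).of_eq fun z => by
    rcases z with n | n
    · have : Encodable.encode (Int.ofNat n) = 2 * n := rfl
      rw [this, if_pos (by omega)]
      simp
    · have : Encodable.encode (Int.negSucc n) = 2 * n + 1 := rfl
      rw [this, if_neg (by omega)]
      rfl

theorem primrec_natCast_sub : Primrec₂ fun m n : ℕ => (m : ℤ) - n :=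
  (Primrec.ite (c := fun q : ℕ × ℕ => q.2 ≤ q.1) (Primrec.nat_le.comp Primrec.snd Primrec.fst)
    (primrec_intCast.comp (Primrec.nat_sub.comp Primrec.fst Primrec.snd))
    (primrec_negSucc.comp (Primrec.nat_sub.comp
      (Primrec.nat_sub.comp Primrec.snd Primrec.fst) (Primrec.const 1)))).of_eq fun q => by
    dsimp only
    split_ifs <;> omega

theorem primrec_int_neg : Primrec fun z : ℤ => -z :=
  (Primrec.ite (c := fun z : ℤ => z.toNat = 0)
    (Primrec.eq.comp primrec_toNat (Primrec.const 0))
    -- For `z ≤ 0`, half of the successor of the code is `-z`; for `z = 0` the division rounds down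
    -- to `0`.
    (primrec_intCast.comp (Primrec.nat_div.comp (Primrec.succ.comp Primrec.encode)
      (Primrec.const 2)))
    (primrec_natCast_sub.comp (Primrec.const 0) primrec_toNat)).of_eq fun z => by
    rcases z with n | n
    · have : Encodable.encode (Int.ofNat n) = 2 * n := rfl
      rw [this]
      split_ifs with h
      · obtain rfl : n = 0 := h
        rfl
      · simp
    · have : Encodable.encode (Int.negSucc n) = 2 * n + 1 := rfl
      rw [this, if_pos (Int.toNat_of_nonpos (Int.negSucc_lt_zero n).le), Int.neg_negSucc]
      omega

theorem primrec_int_add : Primrec₂ fun a b : ℤ => a + b :=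
  (primrec_natCast_sub.comp
    (Primrec.nat_add.comp (primrec_toNat.comp Primrec.fst) (primrec_toNat.comp Primrec.snd))
    (Primrec.nat_add.comp (primrec_toNat.comp (primrec_int_neg.comp Primrec.fst))
      (primrec_toNat.comp (primrec_int_neg.comp Primrec.snd)))).of_eq fun q => by
    push_cast; omega

theorem primrec_int_mul : Primrec₂ fun a b : ℤ => a * b :=
  (primrec_natCast_sub.comp
    (Primrec.nat_add.comp
      (Primrec.nat_mul.comp (primrec_toNat.comp Primrec.fst) (primrec_toNat.comp Primrec.snd))
      (Primrec.nat_mul.comp (primrec_toNat.comp (primrec_int_neg.comp Primrec.fst))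
        (primrec_toNat.comp (primrec_int_neg.comp Primrec.snd))))
    (Primrec.nat_add.comp
      (Primrec.nat_mul.comp (primrec_toNat.comp Primrec.fst)
        (primrec_toNat.comp (primrec_int_neg.comp Primrec.snd)))
      (Primrec.nat_mul.comp (primrec_toNat.comp (primrec_int_neg.comp Primrec.fst))
        (primrec_toNat.comp Primrec.snd)))).of_eq fun q => by
    obtain ⟨a, b⟩ := q
    have ha : a = a.toNat - (-a).toNat := by omega
    have hb : b = b.toNat - (-b).toNat := by omega
    conv_rhs => rw [ha, hb]
    push_cast
    ring

theorem primrec_int_sum : Primrec fun l : List ℤ => l.sum :=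
  (Primrec.list_foldr (h := fun _ q => q.1 + q.2) Primrec.id (Primrec.const 0)
    (primrec_int_add.comp (Primrec.fst.comp Primrec.snd)
      (Primrec.snd.comp Primrec.snd)).to₂).of_eq fun l => by
    induction l <;> simp_all

theorem primrecPred_int_dvd (p : ℕ) : PrimrecPred fun z : ℤ => (p : ℤ) ∣ z :=
  (Primrec.eq.comp (Primrec.nat_mod.comp
    (Primrec.nat_add.comp primrec_toNat (primrec_toNat.comp primrec_int_neg))
    (Primrec.const p)) (Primrec.const 0)).of_eq fun z => by
    rw [← Nat.dvd_iff_mod_eq_zero, Int.natCast_dvd]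
    congr! 1
    omega

theorem primrecPred_evaln_isSome :
    PrimrecPred fun q : (ℕ × Code) × ℕ => (Code.evaln q.1.1 q.1.2 q.2).isSome :=
  (Primrec.eq.comp (Primrec.option_isSome.comp Code.primrec_evaln) (Primrec.const true))

theorem rePred_exists {R : α → ℕ → Prop} (hR : PrimrecPred fun q : α × ℕ => R q.1 q.2) :
    REPred fun a => ∃ x, R a x := by
  classical
  have h : Partrec (fun a => Nat.rfind fun n => Part.some (decide (R a n))) :=
    Partrec.rfind hR.decide.to_comp.partrec
  refine h.dom_re.of_eq fun a => ?_
  refine Nat.rfind_dom.trans ?_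
  constructor
  · rintro ⟨n, hn, -⟩
    exact ⟨n, by simpa using hn⟩
  · rintro ⟨n, hn⟩
    exact ⟨n, by simpa using hn, fun _ => trivial⟩

theorem exists_code_of_rePred {W : α → Prop} (hW : REPred W) :
    ∃ c : Code, ∀ a, W a ↔ (c.eval (Encodable.encode a)).Dom := by
  obtain ⟨c, hc⟩ := Code.exists_code.1 hW
  refine ⟨c, fun a => ?_⟩
  rw [hc]
  simp [Part.assert]

theorem eval_dom_iff {c : Code} {n : ℕ} :
    (c.eval n).Dom ↔ ∃ t, (Code.evaln t c n).isSome := by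
  simp_rw [Part.dom_iff_mem, Code.evaln_complete, Option.isSome_iff_exists]
  exact exists_comm

theorem rePred_eval_dom (c : Code) :
    REPred fun a : α => (c.eval (Encodable.encode a)).Dom :=
  (rePred_exists (R := fun a t => (Code.evaln t c (Encodable.encode a)).isSome)
    (primrecPred_evaln_isSome.comp ((Primrec.snd.pair (Primrec.const c)).pair
      (Primrec.encode.comp Primrec.fst)))).of_eq fun _ => eval_dom_iff.symm

end Primrec

/-! ### Computations with words -/

section Words

variable {n : ℕ}

theorem primrec_coeffAt {X : Type*} [Primcodable X] [DecidableEq X] :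
    Primrec₂ (Word.coeffAt (X := X)) :=
  primrec_int_sum.comp (Primrec.list_map Primrec.fst (Primrec.ite
    (Primrec.eq.comp (Primrec.snd.comp Primrec.snd) (Primrec.snd.comp Primrec.fst))
    (Primrec.fst.comp Primrec.snd) (Primrec.const 0)).to₂)

theorem primrec_diff {X : Type*} [Primcodable X] : Primrec₂ (Word.diff (X := X)) :=
  Primrec.list_append.comp Primrec.fst (Primrec.list_map Primrec.snd
    ((primrec_int_neg.comp (Primrec.fst.comp Primrec.snd)).pair
      (Primrec.snd.comp Primrec.snd)).to₂)

theorem primrec_component : Primrec₂ (Word.component (n := n)) :=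
  primrec_listFilter (R := fun (q : ℕ × Word n) (t : ℤ × List (Fin n)) => t.2.length = q.1)
    Primrec.snd (Primrec.eq.comp
      (Primrec.list_length.comp (Primrec.snd.comp Primrec.snd)) (Primrec.fst.comp Primrec.fst))

end Words

/-! ### The relators attached to a `Π⁰₃` predicate -/

section Construction

/-- The pair of words, and the time bound, coded by a stage. -/
def stage (s : ℕ) : Word 2 × Word 2 × ℕ := (Encodable.decode s).getD ([], [], 0)

/-- The difference of the words coded by a stage. -/
def stageDiff (s : ℕ) : Word 2 := Word.diff (stage s).1 (stage s).2.1

variable (p : ℕ) (Q : ℕ × ℕ × ℕ × ℕ → Prop) (i : ℕ)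

/-- At stage `s`, requirement `e` may add relators of degree `k`. -/
def Allowed (e k s : ℕ) : Prop :=
  e + 30 ≤ k ∧ ∀ a < e + 1, ∃ b < k + 1, ∀ c < s + 1, Q (i, a, b, c)

/-- The stage `s` codes two elements of the `e`-th c.e. set of words that requirement `e` may
identify. -/
def Collides (e s : ℕ) : Prop :=
  (stage s).1 ≠ (stage s).2.1 ∧
  (Code.evaln (stage s).2.2 (Denumerable.ofNat Code e) (Encodable.encode (stage s).1)).isSome ∧
  (Code.evaln (stage s).2.2 (Denumerable.ofNat Code e) (Encodable.encode (stage s).2.1)).isSome ∧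
  ∀ t ∈ stageDiff s,
    (p : ℤ) ∣ Word.coeffAt (stageDiff s) t.2 ∨ Allowed Q i e t.2.length s

/-- Requirement `e` acts at stage `s`. -/
def Acts (e s : ℕ) : Prop := Collides p Q i e s ∧ ∀ s' < s, ¬ Collides p Q i e s'

/-- The relator of degree `k` added by requirement `e` at stage `s`, padded by `0`s from which `e`,
`s` and `k` can be read off. -/
def relatorWord (e s k : ℕ) : Word 2 :=
  Word.component k (stageDiff s) ++ List.replicate (Nat.pair e (Nat.pair s k)) (0, [])

/-- The relators of the `i`-th ring. -/
def relators : Set (Word 2) :=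
  {w | w = [((p : ℤ), [])] ∨ ∃ e s k, Acts p Q i e s ∧ w = relatorWord e s k}

/-- The values of the relators of the `i`-th ring. -/
noncomputable def relatorValues : Set (FreeAlgebra (ZMod p) (Fin 2)) :=
  Word.evalIn (ZMod p) '' relators p Q i

theorem primrec_stage : Primrec stage :=
  Primrec.option_getD.comp Primrec.decode (Primrec.const _)

theorem primrec_stageDiff : Primrec stageDiff :=
  primrec_diff.comp (Primrec.fst.comp primrec_stage)
    (Primrec.fst.comp (Primrec.snd.comp primrec_stage))

variable {p Q i}

/-! ### Deciding the relators uniformly in `i`. -/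

section Computability

variable {α : Type*} [Primcodable α] {fi fe fk fs : α → ℕ}

theorem primrecPred_allowed (hQ : PrimrecPred Q) (hi : Primrec fi) (he : Primrec fe)
    (hk : Primrec fk) (hs : Primrec fs) :
    PrimrecPred fun x => Allowed Q (fi x) (fe x) (fk x) (fs x) := by
  refine (Primrec.nat_le.comp (Primrec.nat_add.comp he (Primrec.const 30)) hk).and ?_
  refine primrecPred_forall_lt (Primrec.succ.comp he) ?_
  refine primrecPred_exists_lt (Primrec.succ.comp (hk.comp Primrec.fst)) ?_
  refine primrecPred_forall_lt (Primrec.succ.comp (hs.comp (Primrec.fst.comp Primrec.fst))) ?_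
  exact hQ.comp ((hi.comp (Primrec.fst.comp (Primrec.fst.comp Primrec.fst))).pair
    ((Primrec.snd.comp (Primrec.fst.comp Primrec.fst)).pair
      ((Primrec.snd.comp Primrec.fst).pair Primrec.snd)))

theorem primrecPred_collides (hQ : PrimrecPred Q) (hi : Primrec fi) (he : Primrec fe)
    (hs : Primrec fs) : PrimrecPred fun x => Collides p Q (fi x) (fe x) (fs x) := by
  have h1 := Primrec.fst.comp (primrec_stage.comp hs)
  have h2 := Primrec.fst.comp (Primrec.snd.comp (primrec_stage.comp hs))
  have h3 := Primrec.snd.comp (Primrec.snd.comp (primrec_stage.comp hs))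
  have hc := (Primrec.ofNat Code).comp he
  refine (Primrec.eq.comp h1 h2).not.and
    ((primrecPred_evaln_isSome.comp ((h3.pair hc).pair (Primrec.encode.comp h1))).and
    ((primrecPred_evaln_isSome.comp ((h3.pair hc).pair (Primrec.encode.comp h2))).and
    (primrecPred_forall_mem (primrec_stageDiff.comp hs) (PrimrecPred.or ?_ ?_))))
  · exact (primrecPred_int_dvd p).comp (primrec_coeffAt.comp
      (primrec_stageDiff.comp (hs.comp Primrec.fst)) (Primrec.snd.comp Primrec.snd))
  · exact primrecPred_allowed hQ (hi.comp Primrec.fst) (he.comp Primrec.fst)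
      (Primrec.list_length.comp (Primrec.snd.comp Primrec.snd)) (hs.comp Primrec.fst)

theorem primrecPred_acts (hQ : PrimrecPred Q) (hi : Primrec fi) (he : Primrec fe)
    (hs : Primrec fs) : PrimrecPred fun x => Acts p Q (fi x) (fe x) (fs x) :=
  (primrecPred_collides hQ hi he hs).and (primrecPred_forall_lt hs
    (primrecPred_collides hQ (hi.comp Primrec.fst) (he.comp Primrec.fst) Primrec.snd).not)

theorem primrec_relatorWord (he : Primrec fe) (hs : Primrec fs) (hk : Primrec fk) :
    Primrec fun x => relatorWord (fe x) (fs x) (fk x) :=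
  Primrec.list_append.comp (primrec_component.comp hk (primrec_stageDiff.comp hs))
    (primrec_list_replicate _ (Primrec₂.natPair.comp he (Primrec₂.natPair.comp hs hk)))

theorem le_length_relatorWord (e s k : ℕ) :
    Nat.pair e (Nat.pair s k) ≤ (relatorWord e s k).length := by
  simp [relatorWord]

/-- The padding makes a relator at least as long as the code of `(e, s, k)`, so the search for its
origin is bounded by its length. -/
theorem primrecPred_relators (hQ : PrimrecPred Q) :
    PrimrecPred fun q : ℕ × Word 2 => q.2 ∈ relators p Q q.1 := by
  have hm : ∀ {f : ℕ → ℕ}, Primrec f →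
      Primrec fun q : (ℕ × Word 2) × ℕ => f q.2 := fun hf => hf.comp Primrec.snd
  have he : Primrec fun m : ℕ => m.unpair.1 := Primrec.fst.comp Primrec.unpair
  have hs : Primrec fun m : ℕ => m.unpair.2.unpair.1 :=
    Primrec.fst.comp (Primrec.unpair.comp (Primrec.snd.comp Primrec.unpair))
  have hk : Primrec fun m : ℕ => m.unpair.2.unpair.2 :=
    Primrec.snd.comp (Primrec.unpair.comp (Primrec.snd.comp Primrec.unpair))
  have h1 : PrimrecPred fun q : ℕ × Word 2 => q.2 = [((p : ℤ), [])] :=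
    Primrec.eq.comp Primrec.snd (Primrec.const _)
  have h2 : PrimrecPred fun q : ℕ × Word 2 => ∃ m < q.2.length + 1,
      Acts p Q q.1 m.unpair.1 m.unpair.2.unpair.1 ∧
        q.2 = relatorWord m.unpair.1 m.unpair.2.unpair.1 m.unpair.2.unpair.2 :=
    primrecPred_exists_lt (Primrec.succ.comp (Primrec.list_length.comp Primrec.snd))
      ((primrecPred_acts hQ (Primrec.fst.comp Primrec.fst) (hm he) (hm hs)).and
        (Primrec.eq.comp (Primrec.snd.comp Primrec.fst)
          (primrec_relatorWord (hm he) (hm hs) (hm hk))))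
  refine (h1.or h2).of_eq fun q => or_congr Iff.rfl ⟨?_, ?_⟩
  · rintro ⟨m, -, h, h'⟩
    exact ⟨_, _, _, h, h'⟩
  · rintro ⟨e, s, k, h, h'⟩
    refine ⟨Nat.pair e (Nat.pair s k), ?_, by simpa using h, by simpa using h'⟩
    rw [h']
    exact Nat.lt_succ_of_le (le_length_relatorWord e s k)

end Computability

/-! ### Homogeneity and number of the relators. -/

theorem Acts.unique {e s s' : ℕ} (h : Acts p Q i e s) (h' : Acts p Q i e s') : s = s' := by
  rcases lt_trichotomy s s' with hlt | heq | hlt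
  · exact absurd h.1 (h'.2 s hlt)
  · exact heq
  · exact absurd h'.1 (h.2 s' hlt)

theorem evalIn_relatorWord (e s k : ℕ) :
    (relatorWord e s k).evalIn (ZMod p) = (Word.component k (stageDiff s)).evalIn (ZMod p) := by
  rw [relatorWord, Word.evalIn_append, Word.evalIn_replicate_zero, add_zero]

theorem char_mem_relators : [((p : ℤ), [])] ∈ relators p Q i := Or.inl rfl

theorem component_mem_relatorValues {e s : ℕ} (h : Acts p Q i e s) (k : ℕ) :
    (Word.component k (stageDiff s)).evalIn (ZMod p) ∈ relatorValues p Q i :=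
  ⟨relatorWord e s k, Or.inr ⟨e, s, k, h, rfl⟩, evalIn_relatorWord e s k⟩

theorem mem_relatorValues {f : FreeAlgebra (ZMod p) (Fin 2)} (hf : f ∈ relatorValues p Q i) :
    f = 0 ∨ ∃ e s k, Acts p Q i e s ∧ f = (Word.component k (stageDiff s)).evalIn (ZMod p) := by
  obtain ⟨w, rfl | ⟨e, s, k, h, rfl⟩, rfl⟩ := hf
  · left
    simp
  · exact Or.inr ⟨e, s, k, h, evalIn_relatorWord e s k⟩

theorem isHomogeneousSet_relatorValues : IsHomogeneousSet (relatorValues p Q i) := by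
  intro f hf
  obtain rfl | ⟨e, s, k, -, rfl⟩ := mem_relatorValues hf
  · exact ⟨0, zero_mem _⟩
  · exact ⟨k, Word.evalIn_component_mem k _⟩

/-- A nonzero component has a monomial whose coefficient is not divisible by `p`, and at such a
monomial `Collides` leaves only the alternative `Allowed`. -/
theorem exists_acts_of_mem_relatorValues {f : FreeAlgebra (ZMod p) (Fin 2)} {k : ℕ}
    (hf : f ∈ relatorValues p Q i) (h0 : f ≠ 0) (hk : f ∈ homogeneousPart p k) :
    ∃ e s, Acts p Q i e s ∧ Allowed Q i e k s ∧
      f = (Word.component k (stageDiff s)).evalIn (ZMod p) := by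
  obtain rfl | ⟨e, s, k', h, rfl⟩ := mem_relatorValues hf
  · exact absurd rfl h0
  obtain rfl := eq_of_mem_homogeneousPart h0 hk (Word.evalIn_component_mem k' _)
  refine ⟨e, s, h, ?_, rfl⟩
  obtain ⟨l, hl⟩ : ∃ l, coeff (ZMod p) l ((Word.component k (stageDiff s)).evalIn (ZMod p)) ≠ 0 := by
    by_contra! hall
    exact h0 (ext_coeff fun l => by rw [hall, map_zero])
  rw [Word.coeff_evalIn, Word.coeffAt_component] at hl
  split_ifs at hl with hlk
  · obtain ⟨t, ht, rfl⟩ : ∃ t ∈ stageDiff s, t.2 = l := by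
      by_contra! hne
      rw [Word.coeffAt_eq_zero hne] at hl
      simp at hl
    rw [← hlk]
    refine (h.1.2.2.2 t ht).resolve_left fun hdvd => hl ?_
    rwa [ZMod.intCast_zmod_eq_zero_iff_dvd]
  · simp at hl

/-- Each requirement acts at most once, and only those with `e + 30 ≤ k` can contribute a nonzero
relator of degree `k`. -/
theorem countDegree_relatorValues_le (k : ℕ) : countDegree (relatorValues p Q i) k ≤ k - 29 := by
  classical
  let F : ℕ → FreeAlgebra (ZMod p) (Fin 2) := fun e =>
    if h : ∃ s, Acts p Q i e s then
      (Word.component k (stageDiff h.choose)).evalIn (ZMod p) else 0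
  have hsub : {f | f ∈ relatorValues p Q i ∧ f ≠ 0 ∧ f ∈ homogeneousPart p k} ⊆
      ((Finset.range (k - 29)).image F : Set (FreeAlgebra (ZMod p) (Fin 2))) := by
    rintro f ⟨hf, h0, hk⟩
    obtain ⟨e, s, h, hA, rfl⟩ := exists_acts_of_mem_relatorValues hf h0 hk
    have hex : ∃ s, Acts p Q i e s := ⟨s, h⟩
    rw [Finset.coe_image]
    refine ⟨e, ?_, ?_⟩
    · have := hA.1
      rw [Finset.mem_coe, Finset.mem_range]
      omega
    · simp only [F, dif_pos hex]
      rw [hex.choose_spec.unique h]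
  calc countDegree (relatorValues p Q i) k
      ≤ ((Finset.range (k - 29)).image F : Set (FreeAlgebra (ZMod p) (Fin 2))).ncard :=
        Set.ncard_le_ncard hsub (Finset.finite_toSet _)
    _ ≤ k - 29 := by
        rw [Set.ncard_coe_finset]
        exact Finset.card_image_le.trans (Finset.card_range _).le

theorem golodShafarevich_relatorValues : GolodShafarevich (relatorValues p Q i) := by
  refine ⟨1 / 4, by norm_num, by norm_num, ?_, ?_, fun k hk => ?_⟩
  · simpa using countDegree_relatorValues_le (p := p) (Q := Q) (i := i) 0
  · simpa using countDegree_relatorValues_le (p := p) (Q := Q) (i := i) 1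
  · refine (Nat.cast_le.2 (countDegree_relatorValues_le k)).trans ?_
    rcases le_or_gt k 29 with h | h
    · rw [Nat.sub_eq_zero_of_le h]
      norm_num
    · obtain ⟨j, rfl⟩ := Nat.exists_eq_add_of_lt h
      rw [show 29 + j + 1 - 29 = j + 1 by omega, show 29 + j + 1 - 2 = 27 + (j + 1) by omega,
        pow_add]
      -- With `ε = 1 / 4` the ratio is `3 / 2`. Bernoulli bounds the last `j + 1` factors below by a
      -- linear function, and the first `27` factors outweigh `ε ^ 2`.
      have h1 := one_add_mul_le_pow (a := (1 / 2 : ℝ)) (by norm_num) (j + 1)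
      have h2 : (2 - 2 * (1 / 4) : ℝ) = 1 + 1 / 2 := by norm_num
      rw [h2, ← mul_assoc]
      have h3 : (2 : ℝ) ≤ (1 / 4) ^ 2 * (1 + 1 / 2) ^ 27 := by norm_num
      refine le_trans ?_ (mul_le_mul h3 h1 (by positivity) (by positivity))
      push_cast
      linarith

/-! ### The dark case -/

theorem monomial_sub_monomial_notMem_span {H : Set (FreeAlgebra (ZMod p) (Fin 2))}
    (hH : IsHomogeneousSet H) {l m : List (Fin 2)} (hlm : l.length ≠ m.length)
    (hl : monomial (ZMod p) l ∉ TwoSidedIdeal.span H) :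
    monomial (ZMod p) l - monomial (ZMod p) m ∉ TwoSidedIdeal.span H := by
  intro h
  have h1 := homogeneousProj_mem_idealPart hH h l.length
  rw [map_sub, homogeneousProj_monomial, homogeneousProj_monomial, if_pos rfl, if_neg hlm.symm,
    sub_zero] at h1
  exact hl (mem_span_of_mem_idealPart h1)

/-- Words for monomials of different degrees are inequivalent unless both vanish. -/
theorem not_wordProblem_monomial {l m : List (Fin 2)} (hlm : l.length ≠ m.length)
    (hl : monomial (ZMod p) l ∉ TwoSidedIdeal.span (relatorValues p Q i)) :
    ¬ (wordProblem (relators p Q i)).r [(1, l)] [(1, m)] := by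
  rw [wordProblem_iff char_mem_relators, Word.evalIn_diff]
  simp only [Word.evalIn_cons, Word.evalIn_nil, Int.cast_one, one_smul, add_zero]
  exact monomial_sub_monomial_notMem_span isHomogeneousSet_relatorValues hlm hl

/-- The surviving monomials, one in each degree, are pairwise inequivalent. -/
theorem infinite_quotient_wordProblem [Fact p.Prime] :
    Infinite (Quotient (wordProblem (relators p Q i))) := by
  choose l hl hl' using exists_monomial_notMem_span
    (isHomogeneousSet_relatorValues (p := p) (Q := Q) (i := i)) golodShafarevich_relatorValues
  refine Infinite.of_injective
    (fun n : ℕ => (Quotient.mk _ [(1, l n)] : Quotient (wordProblem (relators p Q i)))) ?_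
  intro m n hmn
  by_contra hne
  exact not_wordProblem_monomial (by rwa [hl, hl]) (hl' m) (Quotient.exact hmn)

theorem Word.coeffAt_diff {n : ℕ} (w₁ w₂ : Word n) (l : List (Fin n)) :
    coeffAt (diff w₁ w₂) l = coeffAt w₁ l - coeffAt w₂ l := by
  have h := coeff_evalIn ℤ (diff w₁ w₂) l
  rw [evalIn_diff, map_sub, coeff_evalIn, coeff_evalIn] at h
  simpa using h.symm

/-- The difference of the two words is the sum of its components, all of which are relators. -/
theorem wordProblem_of_acts {e s : ℕ} (h : Acts p Q i e s) :
    (wordProblem (relators p Q i)).r (stage s).1 (stage s).2.1 := by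
  rw [wordProblem_iff char_mem_relators]
  change Word.evalIn (ZMod p) (stageDiff s) ∈ TwoSidedIdeal.span (relatorValues p Q i)
  obtain ⟨N, hN⟩ : ∃ N, ∀ t ∈ stageDiff s, t.2.length < N := by
    refine ⟨((stageDiff s).map fun t => t.2.length).sum + 1, fun t ht => ?_⟩
    exact Nat.lt_succ_of_le (List.single_le_sum (by simp) _ (List.mem_map_of_mem ht))
  rw [← Word.sum_evalIn_component _ _ hN]
  exact sum_mem fun k _ => TwoSidedIdeal.subset_span (component_mem_relatorValues h k)

theorem not_isLight_wordProblem [Fact p.Prime] (hQ : ∀ a, ∃ b, ∀ c, Q (i, a, b, c)) :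
    ¬ IsLight (wordProblem (relators p Q i)) := by
  rintro ⟨W, hW, hinf, hne⟩
  obtain ⟨c, hc⟩ := exists_code_of_rePred hW
  set e := Encodable.encode c
  have he : Denumerable.ofNat Code e = c := Denumerable.ofNat_encode c
  choose b hb using hQ
  -- From degree `K` on, the witnesses `b a` for all `a ≤ e` fit below the degree, and as true
  -- witnesses they are never refuted.
  set K := e + 30 + ∑ a ∈ Finset.range (e + 1), b a
  have hallow : ∀ k, K ≤ k → ∀ s, Allowed Q i e k s := by
    refine fun k hk s => ⟨by omega, fun a ha => ⟨b a, ?_, fun c _ => hb a c⟩⟩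
    have := Finset.single_le_sum (f := b) (fun _ _ => Nat.zero_le _) (Finset.mem_range.2 ha)
    omega
  have : Infinite W := hinf.to_subtype
  have : Finite {l : List (Fin 2) // l.length < K} := List.finite_length_lt (Fin 2) K
  -- Pigeonhole: modulo `p` there are finitely many possible coefficient vectors in degrees below
  -- `K`.
  obtain ⟨⟨w₁, hw₁⟩, ⟨w₂, hw₂⟩, hne₁₂, heq⟩ := Finite.exists_ne_map_eq_of_infinite
    fun (w : W) (l : {l : List (Fin 2) // l.length < K}) => (Word.coeffAt w.1 l.1 : ZMod p)
  obtain ⟨t₁, ht₁⟩ := eval_dom_iff.1 ((hc w₁).1 hw₁)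
  obtain ⟨t₂, ht₂⟩ := eval_dom_iff.1 ((hc w₂).1 hw₂)
  have hmono : ∀ {t t' n}, t ≤ t' → (Code.evaln t c n).isSome → (Code.evaln t' c n).isSome := by
    intro t t' n htt' h
    obtain ⟨x, hx⟩ := Option.isSome_iff_exists.1 h
    exact Option.isSome_iff_exists.2 ⟨x, Code.evaln_mono htt' hx⟩
  have hcol : ∃ s, Collides p Q i e s := by
    refine ⟨Encodable.encode (w₁, w₂, max t₁ t₂), ?_⟩
    have hst : stage (Encodable.encode (w₁, w₂, max t₁ t₂)) = (w₁, w₂, max t₁ t₂) := by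
      rw [stage, Encodable.encodek, Option.getD_some]
    rw [Collides, hst, he]
    refine ⟨fun h => hne₁₂ (Subtype.ext h), hmono (le_max_left _ _) ht₁,
      hmono (le_max_right _ _) ht₂, fun t _ => ?_⟩
    rcases lt_or_ge t.2.length K with hlt | hge
    · left
      rw [stageDiff, hst, Word.coeffAt_diff, ← ZMod.intCast_zmod_eq_zero_iff_dvd, Int.cast_sub,
        sub_eq_zero]
      exact congrFun heq ⟨t.2, hlt⟩
    · exact Or.inr (hallow _ hge _)
  classical
  -- The first collision may involve another pair than `w₁`, `w₂`; any two distinct members of `W`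
  -- will do.
  have hact : Acts p Q i e (Nat.find hcol) :=
    ⟨Nat.find_spec hcol, fun s hs => Nat.find_min hcol hs⟩
  obtain ⟨hne', h1, h2, -⟩ := hact.1
  rw [he] at h1 h2
  exact hne _ ((hc _).2 (eval_dom_iff.2 ⟨_, h1⟩)) _ ((hc _).2 (eval_dom_iff.2 ⟨_, h2⟩)) hne'
    (wordProblem_of_acts hact)

end Construction

/-! ### Linear functionals coded by words -/

namespace Word

variable {n : ℕ}

/-- The value on `v` of the linear functional that maps a monomial to its coefficient in `u`. -/
def pairing (u v : Word n) : ℤ := (v.map fun t => t.1 * coeffAt u t.2).sum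

/-- The product of a monomial, a word and a monomial. -/
def sandwich (l : List (Fin n)) (w : Word n) (r : List (Fin n)) : Word n :=
  w.map fun t => (t.1, l ++ t.2 ++ r)

theorem evalIn_sandwich (K : Type*) [CommRing K] (l r : List (Fin n)) (w : Word n) :
    evalIn K (sandwich l w r) = monomial K l * evalIn K w * monomial K r := by
  induction w with
  | nil => simp [sandwich]
  | cons t w ih =>
    rw [sandwich] at ih
    rw [sandwich, List.map_cons, evalIn_cons, evalIn_cons, ih, mul_add, add_mul,
      monomial_append, monomial_append, mul_smul_comm, smul_mul_assoc]

theorem pairing_eq_zero {u v : Word n} (h : ∀ t ∈ v, coeffAt u t.2 = 0) : pairing u v = 0 := by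
  refine List.sum_eq_zero fun x hx => ?_
  obtain ⟨t, ht, rfl⟩ := List.mem_map.1 hx
  rw [h t ht, mul_zero]

theorem map_evalIn {K : Type*} [CommRing K] (φ : FreeAlgebra K (Fin n) →ₗ[K] K) {u v : Word n}
    (h : ∀ t ∈ v, φ (monomial K t.2) = (coeffAt u t.2 : K)) :
    φ (evalIn K v) = (pairing u v : K) := by
  induction v with
  | nil => simp [pairing]
  | cons t v ih =>
    rw [evalIn_cons, map_add, map_smul, h t List.mem_cons_self,
      ih fun t ht => h t (List.mem_cons_of_mem _ ht)]
    simp [pairing]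

/-- Every function on the monomials of degree `d` is given by the coefficients of a word. -/
theorem exists_coeffAt_eq (d : ℕ) (g : List (Fin n) → ℤ) :
    ∃ u : Word n, (∀ t ∈ u, t.2.length = d) ∧ ∀ l, l.length = d → coeffAt u l = g l := by
  set L := (List.finite_length_eq (Fin n) d).toFinset.toList
  refine ⟨L.map fun l => (g l, l), ?_, fun l hl => ?_⟩
  · intro t ht
    obtain ⟨l, hl, rfl⟩ := List.mem_map.1 ht
    simpa [L] using hl
  · have hl' : l ∈ (List.finite_length_eq (Fin n) d).toFinset := by simpa using hl
    rw [coeffAt, List.map_map, Finset.sum_map_toList]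
    simp only [Function.comp_apply]
    rw [Finset.sum_ite_eq', if_pos hl']

end Word

section Primrec

variable {n : ℕ}

theorem primrec_pairing : Primrec₂ (Word.pairing (n := n)) :=
  primrec_int_sum.comp (Primrec.list_map Primrec.snd
    (primrec_int_mul.comp (Primrec.fst.comp Primrec.snd)
      (primrec_coeffAt.comp (Primrec.fst.comp Primrec.fst)
        (Primrec.snd.comp Primrec.snd))).to₂)

theorem primrec_sandwich {α : Type*} [Primcodable α] {l r : α → List (Fin n)} {w : α → Word n}
    (hl : Primrec l) (hw : Primrec w) (hr : Primrec r) :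
    Primrec fun x => Word.sandwich (l x) (w x) (r x) :=
  Primrec.list_map hw ((Primrec.fst.comp Primrec.snd).pair
    (Primrec.list_append.comp (Primrec.list_append.comp (hl.comp Primrec.fst)
      (Primrec.snd.comp Primrec.snd)) (hr.comp Primrec.fst))).to₂

end Primrec

/-! ### The light case -/

section Light

variable (p : ℕ) (Q : ℕ × ℕ × ℕ × ℕ → Prop) (i a s₀ : ℕ)

/-- A certificate `(n, s₁, u, m)` for the nonvanishing of the monomial `m` of degree `n`: the
functional coded by `u` vanishes on the degree `n` part of the ideal, but not on `m`. -/
def IsCertificate (q : ℕ × ℕ × Word 2 × List (Fin 2)) : Prop :=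
  s₀ ≤ q.2.1 ∧ (∀ b < q.1 + 1, ∃ c < q.2.1 + 1, ¬ Q (i, a, b, c)) ∧
  q.2.2.2.length = q.1 ∧ (∀ t ∈ q.2.2.1, t.2.length = q.1) ∧
  ¬ (p : ℤ) ∣ Word.coeffAt q.2.2.1 q.2.2.2 ∧
  ∀ s < q.2.1, ∀ e < q.1 + 1, Acts p Q i e s → ∀ k < q.1 + 1, ∀ t ∈ q.2.2.1,
    ∀ j < q.1 + 1, ∀ j' < q.1 + 1,
      (p : ℤ) ∣ Word.pairing q.2.2.1
        (Word.sandwich (t.2.take j) (Word.component k (stageDiff s)) (t.2.drop j'))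

variable {p Q i a s₀}

theorem primrecPred_isCertificate (hQ : PrimrecPred Q) :
    PrimrecPred (IsCertificate p Q i a s₀) := by
  have f1 : ∀ {α : Type} [Primcodable α] {f : α → ℕ × ℕ × Word 2 × List (Fin 2)}, Primrec f →
      Primrec fun x => (f x).1 := fun hf => Primrec.fst.comp hf
  have f2 : ∀ {α : Type} [Primcodable α] {f : α → ℕ × ℕ × Word 2 × List (Fin 2)}, Primrec f →
      Primrec fun x => (f x).2.1 := fun hf => Primrec.fst.comp (Primrec.snd.comp hf)
  have f3 : ∀ {α : Type} [Primcodable α] {f : α → ℕ × ℕ × Word 2 × List (Fin 2)}, Primrec f →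
      Primrec fun x => (f x).2.2.1 :=
    fun hf => Primrec.fst.comp (Primrec.snd.comp (Primrec.snd.comp hf))
  have f4 : ∀ {α : Type} [Primcodable α] {f : α → ℕ × ℕ × Word 2 × List (Fin 2)}, Primrec f →
      Primrec fun x => (f x).2.2.2 :=
    fun hf => Primrec.snd.comp (Primrec.snd.comp (Primrec.snd.comp hf))
  have id' := Primrec.id (α := ℕ × ℕ × Word 2 × List (Fin 2))
  refine (Primrec.nat_le.comp (Primrec.const s₀) (f2 id')).and (PrimrecPred.and ?_
    ((Primrec.eq.comp (Primrec.list_length.comp (f4 id')) (f1 id')).and (PrimrecPred.and ?_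
    (PrimrecPred.and ?_ ?_))))
  · refine primrecPred_forall_lt (Primrec.succ.comp (f1 id')) ?_
    refine primrecPred_exists_lt (Primrec.succ.comp (f2 Primrec.fst)) ?_
    exact (hQ.comp ((Primrec.const i).pair ((Primrec.const a).pair
      ((Primrec.snd.comp Primrec.fst).pair Primrec.snd)))).not
  · exact primrecPred_forall_mem (f3 id')
      (Primrec.eq.comp (Primrec.list_length.comp (Primrec.snd.comp Primrec.snd)) (f1 Primrec.fst))
  · exact ((primrecPred_int_dvd p).comp (primrec_coeffAt.comp (f3 id') (f4 id'))).not
  · refine primrecPred_forall_lt (f2 id') ?_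
    refine primrecPred_forall_lt (Primrec.succ.comp (f1 Primrec.fst)) ?_
    refine primrecPred_imp (primrecPred_acts hQ (Primrec.const i) Primrec.snd
      (Primrec.snd.comp Primrec.fst)) ?_
    refine primrecPred_forall_lt (Primrec.succ.comp (f1 (Primrec.fst.comp Primrec.fst))) ?_
    have b1 : Primrec fun x : (((ℕ × ℕ × Word 2 × List (Fin 2)) × ℕ) × ℕ) × ℕ => x.1.1.1 :=
      Primrec.fst.comp (Primrec.fst.comp Primrec.fst)
    refine primrecPred_forall_mem (f3 b1) ?_
    refine primrecPred_forall_lt (Primrec.succ.comp (f1 (b1.comp Primrec.fst))) ?_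
    refine primrecPred_forall_lt
      (Primrec.succ.comp (f1 (b1.comp (Primrec.fst.comp Primrec.fst)))) ?_
    refine (primrecPred_int_dvd p).comp (primrec_pairing.comp
      (f3 (b1.comp (Primrec.fst.comp (Primrec.fst.comp Primrec.fst)))) (primrec_sandwich ?_ ?_ ?_))
    · exact Primrec.list_take.comp (Primrec.snd.comp Primrec.fst)
        (Primrec.snd.comp (Primrec.snd.comp (Primrec.fst.comp Primrec.fst)))
    · exact primrec_component.comp
        (Primrec.snd.comp (Primrec.fst.comp (Primrec.fst.comp Primrec.fst)))
        (primrec_stageDiff.comp (Primrec.snd.comp (Primrec.fst.comp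
          (Primrec.fst.comp (Primrec.fst.comp (Primrec.fst.comp Primrec.fst))))))
    · exact Primrec.list_drop.comp Primrec.snd
        (Primrec.snd.comp (Primrec.snd.comp (Primrec.fst.comp Primrec.fst)))

/-- Every nonzero relator of degree at most `n` appears before stage `s₁`, so the finitely many
tests in the certificate show that the functional vanishes on the whole degree `n` part of the
ideal. -/
theorem IsCertificate.notMem_span (hs₀ : ∀ e < a, ∀ s, Acts p Q i e s → s < s₀)
    {q : ℕ × ℕ × Word 2 × List (Fin 2)} (hq : IsCertificate p Q i a s₀ q) :
    monomial (ZMod p) q.2.2.2 ∉ TwoSidedIdeal.span (relatorValues p Q i) := by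
  obtain ⟨n, s₁, u, m⟩ := q
  obtain ⟨hs, hbc, hm, hu, hdvd, hrel⟩ := hq
  dsimp only at hs hbc hm hu hdvd hrel ⊢
  set φ : FreeAlgebra (ZMod p) (Fin 2) →ₗ[ZMod p] ZMod p :=
    (FreeAlgebra.basisFreeMonoid (ZMod p) (Fin 2)).constr (ZMod p)
      fun l => (Word.coeffAt u (FreeMonoid.toList l) : ZMod p)
  have hφ : ∀ l, φ (monomial (ZMod p) l) = (Word.coeffAt u l : ZMod p) := by
    intro l
    rw [← basisFreeMonoid_ofList, Module.Basis.constr_basis]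
    rfl
  intro hmem
  have hmem' := mem_idealPart_of_mem_span isHomogeneousSet_relatorValues hmem
    (hm ▸ monomial_mem_homogeneousPart m)
  have hker : idealPart (relatorValues p Q i) n ≤ LinearMap.ker φ := by
    rw [idealPart, Submodule.span_le]
    rintro _ ⟨l, r, k, h, hh, hne, hk, hn, rfl⟩
    obtain ⟨e, s, hact, hall, rfl⟩ := exists_acts_of_mem_relatorValues hh hne hk
    rw [SetLike.mem_coe, LinearMap.mem_ker, ← Word.evalIn_sandwich,
      Word.map_evalIn φ fun t _ => hφ t.2, ZMod.intCast_zmod_eq_zero_iff_dvd]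
    -- Requirements below `a` have finished by `s₀`. For the others, a relator of degree at most `n`
    -- needs an unrefuted `b ≤ n`, and by stage `s₁` all of these are refuted.
    have hlt : s < s₁ := by
      by_contra hle
      rcases lt_or_ge e a with hea | hea
      · exact hle ((hs₀ e hea s hact).trans_le hs)
      · obtain ⟨b, hb, hbQ⟩ := hall.2 a (by omega)
        obtain ⟨c, hc, hcQ⟩ := hbc b (by omega)
        exact hcQ (hbQ c (by omega))
    -- Only contexts `(l, r)` cut out of a monomial of `u` need testing; in any other context the
    -- functional is zero term by term.
    by_cases hex : ∃ t ∈ u, t.2.take l.length = l ∧ t.2.drop (l.length + k) = r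
    · obtain ⟨t, ht, htl, htr⟩ := hex
      have := hrel s hlt e (by have := hall.1; omega) hact k (by omega) t ht l.length (by omega)
        (l.length + k) (by omega)
      rwa [htl, htr] at this
    · rw [Word.pairing_eq_zero]
      · exact dvd_zero _
      · intro t ht
        obtain ⟨t', ht', rfl⟩ := List.mem_map.1 ht
        refine Word.coeffAt_eq_zero fun x hx hxt => hex ⟨x, hx, ?_⟩
        have hk' : t'.2.length = k := by simpa using (List.mem_filter.1 ht').2
        rw [hxt]
        dsimp only
        constructor
        · rw [List.append_assoc, List.take_left]
        · rw [← hk', ← List.length_append, List.drop_left]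
  have h0 : φ (monomial (ZMod p) m) = 0 := hker hmem'
  rw [hφ, ZMod.intCast_zmod_eq_zero_iff_dvd] at h0
  exact hdvd h0

/-- A monomial outside the ideal is separated from the degree `n` part by a linear functional, whose
values on monomials lift to integer coefficients. -/
theorem exists_isCertificate [Fact p.Prime] (ha : ∀ b, ∃ c, ¬ Q (i, a, b, c)) (n : ℕ) :
    ∃ q, IsCertificate p Q i a s₀ q ∧ q.1 = n := by
  obtain ⟨m, hm, hnot⟩ := exists_monomial_notMem_span
    (isHomogeneousSet_relatorValues (p := p) (Q := Q) (i := i)) golodShafarevich_relatorValues n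
  obtain ⟨φ, hφm, hφ⟩ := Submodule.exists_le_ker_of_notMem
    (p := idealPart (relatorValues p Q i) n) fun h => hnot (mem_span_of_mem_idealPart h)
  obtain ⟨u, hu, huφ⟩ := Word.exists_coeffAt_eq n fun l => ((φ (monomial (ZMod p) l)).val : ℤ)
  have huφ' : ∀ l : List (Fin 2), l.length = n →
      φ (monomial (ZMod p) l) = (Word.coeffAt u l : ZMod p) := by
    intro l hl
    rw [huφ l hl]
    simp
  choose c hc using ha
  -- The stage exceeds `s₀` and bounds the refutations `c b` of all `b ≤ n`.
  refine ⟨(n, s₀ + ∑ b ∈ Finset.range (n + 1), c b, u, m), ⟨?_, ?_, hm, hu, ?_, ?_⟩, rfl⟩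
  · exact Nat.le_add_right _ _
  · intro b hb
    refine ⟨c b, ?_, hc b⟩
    have := Finset.single_le_sum (f := c) (fun _ _ => Nat.zero_le _) (Finset.mem_range.2 hb)
    dsimp only at this ⊢
    omega
  · rw [← ZMod.intCast_zmod_eq_zero_iff_dvd]
    rwa [huφ' m hm] at hφm
  · intro s _ e _ hact k _ t _ j _ j' _
    dsimp only
    set l := t.2.take j
    set r := t.2.drop j'
    -- The certificate also tests contexts of the wrong total degree; there the pairing is zero
    -- since `u` lives in degree `n`.
    by_cases hn : l.length + k + r.length = n
    · rw [← ZMod.intCast_zmod_eq_zero_iff_dvd, ← Word.map_evalIn φ, Word.evalIn_sandwich]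
      · refine hφ (mem_idealPart_of_mem_span isHomogeneousSet_relatorValues ?_ ?_)
        · exact TwoSidedIdeal.mul_mem_right _ _ _ (TwoSidedIdeal.mul_mem_left _ _ _
            (TwoSidedIdeal.subset_span (component_mem_relatorValues hact k)))
        · exact hn ▸ monomial_mul_mul_monomial_mem (Word.evalIn_component_mem k _) l r
      · intro x hx
        obtain ⟨y, hy, rfl⟩ := List.mem_map.1 hx
        have hk' : y.2.length = k := by simpa using (List.mem_filter.1 hy).2
        exact huφ' _ (by simp; omega)
    · rw [Word.pairing_eq_zero]
      · exact dvd_zero _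
      · intro x hx
        obtain ⟨y, hy, rfl⟩ := List.mem_map.1 hx
        have hk' : y.2.length = k := by simpa using (List.mem_filter.1 hy).2
        refine Word.coeffAt_eq_zero fun z hz hzy => hn ?_
        have := hu z hz
        rw [hzy] at this
        simp at this
        omega

/-- The bound is obtained nonconstructively. This is harmless: lightness only asks that some c.e.
set exist, so `a` and `s₀` may be fixed as finite advice. -/
theorem exists_bound_acts (p : ℕ) (Q : ℕ × ℕ × ℕ × ℕ → Prop) (i a : ℕ) :
    ∃ s₀, ∀ e < a, ∀ s, Acts p Q i e s → s < s₀ := by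
  classical
  have h : ∀ e, ∃ b, ∀ s, Acts p Q i e s → s < b := by
    intro e
    by_cases hex : ∃ s, Acts p Q i e s
    · obtain ⟨s, hs⟩ := hex
      exact ⟨s + 1, fun s' hs' => by rw [hs'.unique hs]; exact Nat.lt_succ_self s⟩
    · exact ⟨0, fun s hs => absurd ⟨s, hs⟩ hex⟩
  choose b hb using h
  refine ⟨∑ e ∈ Finset.range a, b e, fun e he s hs => (hb e s hs).trans_le ?_⟩
  exact Finset.single_le_sum (f := b) (fun _ _ => Nat.zero_le _) (Finset.mem_range.2 he)

/-- The certificate coded by a number. -/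
def certificateAt (z : ℕ) : ℕ × ℕ × Word 2 × List (Fin 2) :=
  (Encodable.decode z).getD (0, 0, [], [])

theorem primrec_certificateAt : Primrec certificateAt :=
  Primrec.option_getD.comp Primrec.decode (Primrec.const _)

/-- Enumerate, for each degree, the monomial of the certificate with the least code. There is one in
every degree, and it survives. -/
theorem isLight_wordProblem [Fact p.Prime] (hQ : PrimrecPred Q)
    (ha : ∀ b, ∃ c, ¬ Q (i, a, b, c)) : IsLight (wordProblem (relators p Q i)) := by
  classical
  obtain ⟨s₀, hs₀⟩ := exists_bound_acts p Q i a
  set C : ℕ → Prop := fun z => IsCertificate p Q i a s₀ (certificateAt z)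
  have hC : PrimrecPred C := (primrecPred_isCertificate hQ).comp primrec_certificateAt
  have hdeg : Primrec fun z => (certificateAt z).1 := Primrec.fst.comp primrec_certificateAt
  have hmon : Primrec fun z => (certificateAt z).2.2.2 :=
    Primrec.snd.comp (Primrec.snd.comp (Primrec.snd.comp primrec_certificateAt))
  set P : Word 2 → ℕ → Prop := fun w z => C z ∧
    (∀ z' < z, C z' → (certificateAt z').1 ≠ (certificateAt z).1) ∧
    w = [(1, (certificateAt z).2.2.2)]
  have hP : PrimrecPred fun q : Word 2 × ℕ => P q.1 q.2 := by
    refine (hC.comp Primrec.snd).and (PrimrecPred.and ?_ ?_)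
    · refine primrecPred_forall_lt Primrec.snd (primrecPred_imp (hC.comp Primrec.snd) ?_)
      exact (Primrec.eq.comp (hdeg.comp Primrec.snd)
        (hdeg.comp (Primrec.snd.comp Primrec.fst))).not
    · exact Primrec.eq.comp Primrec.fst (Primrec.list_cons.comp
        ((Primrec.const 1).pair (hmon.comp Primrec.snd)) (Primrec.const []))
  have hex : ∀ n, ∃ z, C z ∧ (certificateAt z).1 = n := by
    intro n
    obtain ⟨q, hq, hn⟩ := exists_isCertificate (p := p) (s₀ := s₀) ha n
    have : certificateAt (Encodable.encode q) = q := by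
      rw [certificateAt, Encodable.encodek, Option.getD_some]
    exact ⟨Encodable.encode q, by simpa only [C, this] using hq, by rw [this, hn]⟩
  refine ⟨{w | ∃ z, P w z}, rePred_exists hP, ?_, ?_⟩
  · refine Set.infinite_of_injective_forall_mem
      (f := fun n => [(1, (certificateAt (Nat.find (hex n))).2.2.2)]) ?_ ?_
    · intro n n' h
      have h1 := congrArg List.length (congrArg Prod.snd (List.head_eq_of_cons_eq h))
      dsimp only at h1
      rw [(Nat.find_spec (hex n)).1.2.2.1, (Nat.find_spec (hex n')).1.2.2.1,
        (Nat.find_spec (hex n)).2, (Nat.find_spec (hex n')).2] at h1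
      exact h1
    · intro n
      refine ⟨Nat.find (hex n), (Nat.find_spec (hex n)).1, fun z hz hCz hdeg => ?_, rfl⟩
      exact Nat.find_min (hex n) hz ⟨hCz, hdeg.trans (Nat.find_spec (hex n)).2⟩
  · rintro _ ⟨z, hz, hmin, rfl⟩ _ ⟨z', hz', hmin', rfl⟩ hne
    refine not_wordProblem_monomial ?_ (hz.notMem_span hs₀)
    rw [hz.2.2.1, hz'.2.2.1]
    intro hdeg
    rcases lt_trichotomy z z' with hlt | rfl | hlt
    · exact hmin' z hlt hz hdeg
    · exact hne rfl
    · exact hmin z' hlt hz' hdeg.symm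

end Light

/-! ### Hardness -/

theorem IsPi03.exists_primrecPred {S : Set ℕ} (hS : IsPi03 S) :
    ∃ Q : ℕ × ℕ × ℕ × ℕ → Prop, PrimrecPred Q ∧ ∀ x, x ∈ S ↔ ∀ a, ∃ b, ∀ c, Q (x, a, b, c) := by
  obtain ⟨R, hR, hS⟩ := hS
  obtain ⟨c₀, hc₀⟩ := exists_code_of_rePred hR.not.to_re
  -- The last variable packs `c` with a time bound: the new matrix says that the program confirming
  -- `¬ R` has not halted within that time.
  refine ⟨fun q => ¬ (Code.evaln q.2.2.2.unpair.2 c₀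
    (Encodable.encode (q.1, q.2.1, q.2.2.1, q.2.2.2.unpair.1))).isSome, ?_, fun x => ?_⟩
  · have h3 : Primrec fun q : ℕ × ℕ × ℕ × ℕ => q.2.2.1 :=
      Primrec.fst.comp (Primrec.snd.comp Primrec.snd)
    have h4 : Primrec fun q : ℕ × ℕ × ℕ × ℕ => q.2.2.2.unpair :=
      Primrec.unpair.comp (Primrec.snd.comp (Primrec.snd.comp Primrec.snd))
    exact (primrecPred_evaln_isSome.comp (((Primrec.snd.comp h4).pair (Primrec.const c₀)).pair
      (Primrec.encode.comp (Primrec.fst.pair ((Primrec.fst.comp Primrec.snd).pair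
        (h3.pair (Primrec.fst.comp h4))))))).not
  · rw [hS]
    refine forall_congr' fun a => exists_congr fun b => ⟨fun h c hc => ?_, fun h c => ?_⟩
    · exact (hc₀ _).2 (eval_dom_iff.2 ⟨_, hc⟩) (h _)
    · by_contra hc
      obtain ⟨t, ht⟩ := eval_dom_iff.1 ((hc₀ _).1 hc)
      exact h (Nat.pair c t) (by simpa using ht)

theorem exists_code_of_primrec {α : Type*} [Primcodable α] {g : α → ℕ} (hg : Primrec g) :
    ∃ c : Code, ∀ a, c.eval (Encodable.encode a) = Part.some (g a) := by
  obtain ⟨c, hc⟩ := Code.exists_code.1 hg.to_comp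
  refine ⟨c, fun a => ?_⟩
  rw [hc]
  simp

/-- The index of the presentation with `n` generators and program `c`. -/
def index (n : ℕ) (c : Code) : ℕ := Encodable.encode (n, c)

theorem index_iff (P : ℕ → Code → Prop) (n : ℕ) (c : Code) :
    P (gens (index n c)) (prog (index n c)) ↔ P n c := by
  rw [gens, prog, index, Denumerable.ofNat_encode]

/-- The s-m-n theorem: one program for all `i` yields an index for each `i` computably. -/
theorem computable_index_curry (n : ℕ) (c : Code) :
    Computable fun i => index n (Code.curry c i) :=
  (Primrec.encode.comp ((Primrec.const n).pair
    (Code.primrec₂_curry.comp (Primrec.const c) Primrec.id))).to_comp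

theorem mem_darkComputableIndices_index {n : ℕ} {c : Code} :
    index n c ∈ darkComputableIndices ↔ IsComputableIndex (index n c) ∧
      IsDark (wordProblem {w : Word n | 1 ∈ c.eval (Encodable.encode w)}) :=
  and_congr Iff.rfl (index_iff
    (fun n c => IsDark (wordProblem {w : Word n | 1 ∈ c.eval (Encodable.encode w)})) n c)

theorem mem_darkCEIndices_index {n : ℕ} {c : Code} :
    index n c ∈ darkCEIndices ↔
      IsDark (wordProblem {w : Word n | (c.eval (Encodable.encode w)).Dom}) :=
  index_iff
    (fun n c => IsDark (wordProblem {w : Word n | (c.eval (Encodable.encode w)).Dom})) n c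

theorem isDark_wordProblem_relators_iff {p : ℕ} [Fact p.Prime] {Q : ℕ × ℕ × ℕ × ℕ → Prop}
    (hQ : PrimrecPred Q) (i : ℕ) :
    IsDark (wordProblem (relators p Q i)) ↔ ∀ a, ∃ b, ∀ c, Q (i, a, b, c) := by
  constructor
  · intro h
    by_contra! ⟨a, ha⟩
    exact h.2 (isLight_wordProblem hQ ha)
  · exact fun h => ⟨infinite_quotient_wordProblem, not_isLight_wordProblem h⟩

theorem isGolodShafarevichRing_relators (p : ℕ) (Q : ℕ × ℕ × ℕ × ℕ → Prop) (i : ℕ) :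
    IsGolodShafarevichRing p (PresentedRing (relators p Q i)) :=
  ⟨relatorValues p Q i, isHomogeneousSet_relatorValues, golodShafarevich_relatorValues,
    nonempty_presentedRing_ringEquiv char_mem_relators⟩

theorem exists_reduction_darkComputableIndices {p : ℕ} (hp : p.Prime) {S : Set ℕ}
    (hS : IsPi03 S) :
    ∃ f : ℕ → ℕ, Computable f ∧ ∀ i, IsComputableIndex (f i) ∧
      IsGolodShafarevichRing p (PresentedRing (computableRelators (f i))) ∧
      (i ∈ S ↔ f i ∈ darkComputableIndices) := by
  classical
  have : Fact p.Prime := ⟨hp⟩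
  obtain ⟨Q, hQ, hS⟩ := hS.exists_primrecPred
  obtain ⟨c, hc⟩ := exists_code_of_primrec
    (Primrec.ite (primrecPred_relators (p := p) hQ) (Primrec.const 1) (Primrec.const 0))
  have heval : ∀ i (w : Word 2), (Code.curry c i).eval (Encodable.encode w) =
      Part.some (if w ∈ relators p Q i then 1 else 0) := by
    intro i w
    rw [Code.eval_curry]
    exact hc (i, w)
  have hrel : ∀ i, {w : Word 2 | 1 ∈ (Code.curry c i).eval (Encodable.encode w)} =
      relators p Q i := by
    intro i
    ext w
    rw [Set.mem_ofPred_eq, heval, Part.mem_some_iff]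
    split_ifs with h <;> simp [h]
  have hcomp : ∀ i, IsComputableIndex (index 2 (Code.curry c i)) := by
    intro i
    refine (index_iff (fun n c => ∀ w : Word n, 0 ∈ c.eval (Encodable.encode w) ∨
      1 ∈ c.eval (Encodable.encode w)) _ _).2 fun w => ?_
    rw [heval, Part.mem_some_iff, Part.mem_some_iff]
    split_ifs <;> simp
  refine ⟨fun i => index 2 (Code.curry c i), computable_index_curry 2 c, fun i => ⟨hcomp i, ?_, ?_⟩⟩
  · refine (index_iff (fun n c => IsGolodShafarevichRing p
      (PresentedRing {w : Word n | 1 ∈ c.eval (Encodable.encode w)})) _ _).2 ?_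
    rw [hrel]
    exact isGolodShafarevichRing_relators p Q i
  · rw [mem_darkComputableIndices_index, and_iff_right (hcomp i), hrel,
      isDark_wordProblem_relators_iff hQ, hS]

theorem exists_reduction_darkCEIndices {S : Set ℕ} (hS : IsPi03 S) :
    ∃ f : ℕ → ℕ, Computable f ∧ ∀ i, i ∈ S ↔ f i ∈ darkCEIndices := by
  obtain ⟨Q, hQ, hS⟩ := hS.exists_primrecPred
  obtain ⟨c, hc⟩ := exists_code_of_rePred
    (primrecPred_relators (p := 2) hQ).computablePred.to_re
  refine ⟨fun i => index 2 (Code.curry c i), computable_index_curry 2 c, fun i => ?_⟩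
  have hrel : {w : Word 2 | ((Code.curry c i).eval (Encodable.encode w)).Dom} =
      relators 2 Q i := by
    ext w
    rw [Set.mem_ofPred_eq, Code.eval_curry]
    exact (hc (i, w)).symm
  rw [mem_darkCEIndices_index, hrel, isDark_wordProblem_relators_iff hQ, hS]

/-! ### Enumerating the word problem -/

namespace Word

variable {X Y : Type*}

/-- The product of two words. -/
def mul (w₁ w₂ : List (ℤ × List X)) : List (ℤ × List X) :=
  w₁.flatMap fun t => w₂.map fun t' => (t.1 * t'.1, t.2 ++ t'.2)

/-- Renaming the generators in a word. -/
def rename (f : X → Y) (w : List (ℤ × List X)) : List (ℤ × List Y) :=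
  w.map (Prod.map id (List.map f))

/-- The sum of the products `u r v` over a list of quadruples `(u, r, v, t)`. -/
def combine (z : List (List (ℤ × List X) × List (ℤ × List X) × List (ℤ × List X) × ℕ)) :
    List (ℤ × List X) :=
  z.flatMap fun q => mul (mul q.1 q.2.1) q.2.2.1

/-- All coefficients of the word are zero. -/
def IsZero [DecidableEq X] (w : List (ℤ × List X)) : Prop := ∀ t ∈ w, coeffAt w t.2 = 0

theorem evalIn_mul {n : ℕ} (K : Type*) [CommRing K] (w₁ w₂ : Word n) :
    evalIn K (mul w₁ w₂ : Word n) = evalIn K w₁ * evalIn K w₂ := by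
  have h : ∀ (t : ℤ × List (Fin n)) (w : Word n),
      evalIn K (w.map fun t' => (t.1 * t'.1, t.2 ++ t'.2) : Word n) =
        (t.1 : K) • monomial K t.2 * evalIn K w := by
    intro t w
    induction w with
    | nil => simp
    | cons t' w ih =>
      rw [List.map_cons, evalIn_cons, ih, evalIn_cons, mul_add, monomial_append, Int.cast_mul,
        smul_mul_smul_comm]
  induction w₁ with
  | nil => simp [mul]
  | cons t w ih =>
    rw [mul] at ih
    rw [mul, List.flatMap_cons, evalIn_append, h, ih, evalIn_cons, add_mul]

theorem evalIn_combine_cons {n : ℕ} (K : Type*) [CommRing K]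
    (q : Word n × Word n × Word n × ℕ) (z : List (Word n × Word n × Word n × ℕ)) :
    evalIn K (combine (q :: z) : Word n) =
      evalIn K q.1 * evalIn K q.2.1 * evalIn K q.2.2.1 + evalIn K (combine z : Word n) := by
  rw [combine, List.flatMap_cons, evalIn_append, evalIn_mul, evalIn_mul]
  rfl

theorem evalIn_surjective {n : ℕ} (f : FreeAlgebra ℤ (Fin n)) :
    ∃ w : Word n, evalIn ℤ w = f := by
  have hf : f ∈ Submodule.span ℤ (Set.range (monomial ℤ : List (Fin n) → _)) :=
    span_range_monomial (K := ℤ) ▸ Submodule.mem_top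
  induction hf using Submodule.span_induction with
  | mem f hf =>
    obtain ⟨l, rfl⟩ := hf
    exact ⟨[(1, l)], by simp [Algebra.smul_def]⟩
  | zero => exact ⟨[], rfl⟩
  | add f g _ _ hf hg =>
    obtain ⟨u, rfl⟩ := hf
    obtain ⟨v, rfl⟩ := hg
    exact ⟨u ++ v, evalIn_append _ _ _⟩
  | smul c f _ hf =>
    obtain ⟨u, rfl⟩ := hf
    refine ⟨mul [(c, [])] u, ?_⟩
    rw [evalIn_mul]
    simp [Algebra.smul_def]

/-- Monomials that do not occur in the word have coefficient zero anyway, so a finite test suffices.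
-/
theorem isZero_iff {n : ℕ} {w : Word n} : IsZero w ↔ evalIn ℤ w = 0 := by
  constructor
  · intro h
    refine ext_coeff fun l => ?_
    rw [coeff_evalIn, map_zero, Int.cast_id]
    by_cases hl : ∃ t ∈ w, t.2 = l
    · obtain ⟨t, ht, rfl⟩ := hl
      exact h t ht
    · exact coeffAt_eq_zero fun t ht htl => hl ⟨t, ht, htl⟩
  · intro h t _
    have := coeff_evalIn ℤ w t.2
    rw [h, map_zero, Int.cast_id] at this
    exact this.symm

theorem evalIn_combine_neg {n : ℕ} (z : List (Word n × Word n × Word n × ℕ)) :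
    evalIn ℤ (combine (z.map fun q => (mul [(-1, [])] q.1, q.2)) : Word n) =
      -evalIn ℤ (combine z : Word n) := by
  induction z with
  | nil => simp [combine]
  | cons q z ih =>
    rw [List.map_cons, evalIn_combine_cons, ih, evalIn_combine_cons, evalIn_mul]
    simp [Algebra.smul_def]
    abel

/-- The fourth entry of a quadruple witnesses that the second is a relator. Signs are absorbed into
the left factors, so plain sums of products `u r v` already form the ideal. -/
theorem mem_relatorIdeal_iff_exists {n : ℕ} {R : Set (Word n)} {T : Word n → ℕ → Prop}
    (hT : ∀ w, w ∈ R ↔ ∃ t, T w t) {f : FreeAlgebra ℤ (Fin n)} :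
    f ∈ relatorIdeal R ↔ ∃ z : List (Word n × Word n × Word n × ℕ),
      (∀ q ∈ z, T q.2.1 q.2.2.2) ∧ evalIn ℤ (combine z : Word n) = f := by
  constructor
  · intro hf
    rw [relatorIdeal, TwoSidedIdeal.mem_span_iff_mem_addSubgroup_closure] at hf
    induction hf using AddSubgroup.closure_induction with
    | mem f hf =>
      obtain ⟨_, ⟨a, -, _, ⟨w, hw, rfl⟩, rfl⟩, b, -, rfl⟩ := hf
      obtain ⟨u, rfl⟩ := evalIn_surjective a
      obtain ⟨v, rfl⟩ := evalIn_surjective b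
      obtain ⟨t, ht⟩ := (hT w).1 hw
      refine ⟨[(u, w, v, t)], by simpa using ht, ?_⟩
      rw [evalIn_combine_cons, eval_eq_evalIn]
      exact add_zero _
    | zero => exact ⟨[], by simp, rfl⟩
    | add f g _ _ hf hg =>
      obtain ⟨z, hz, rfl⟩ := hf
      obtain ⟨z', hz', rfl⟩ := hg
      refine ⟨z ++ z', fun q hq => ?_, ?_⟩
      · rcases List.mem_append.1 hq with h | h
        · exact hz q h
        · exact hz' q h
      · rw [combine, List.flatMap_append, evalIn_append]
        rfl
    | neg f _ hf =>
      obtain ⟨z, hz, rfl⟩ := hf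
      refine ⟨z.map fun q => (mul [(-1, [])] q.1, q.2), fun q hq => ?_, ?_⟩
      · obtain ⟨q', hq', rfl⟩ := List.mem_map.1 hq
        exact hz q' hq'
      · exact evalIn_combine_neg z
  · rintro ⟨z, hz, rfl⟩
    induction z with
    | nil => exact zero_mem _
    | cons q z ih =>
      rw [evalIn_combine_cons]
      refine add_mem ?_ (ih fun q hq => hz q (List.mem_cons_of_mem _ hq))
      refine TwoSidedIdeal.mul_mem_right _ _ _ (TwoSidedIdeal.mul_mem_left _ _ _
        (TwoSidedIdeal.subset_span ⟨q.2.1, (hT _).2 ⟨_, hz q List.mem_cons_self⟩, ?_⟩))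
      exact eval_eq_evalIn _

theorem wordProblem_iff_exists {n : ℕ} {R : Set (Word n)} {T : Word n → ℕ → Prop}
    (hT : ∀ w, w ∈ R ↔ ∃ t, T w t) (w₁ w₂ : Word n) :
    (wordProblem R).r w₁ w₂ ↔ ∃ z : List (Word n × Word n × Word n × ℕ),
      (∀ q ∈ z, T q.2.1 q.2.2.2) ∧ IsZero (diff (diff w₁ w₂) (combine z)) := by
  have h : (wordProblem R).r w₁ w₂ ↔ w₁.eval - w₂.eval ∈ relatorIdeal R := by
    rw [← TwoSidedIdeal.rel_iff]
    exact Quotient.eq''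
  rw [h, mem_relatorIdeal_iff_exists hT]
  refine exists_congr fun z => and_congr_right fun _ => ?_
  rw [isZero_iff, evalIn_diff, evalIn_diff, eval_eq_evalIn, eval_eq_evalIn, sub_eq_zero]
  exact eq_comm

theorem rename_diff (f : X → Y) (w₁ w₂ : List (ℤ × List X)) :
    rename f (diff w₁ w₂) = diff (rename f w₁) (rename f w₂) := by
  simp [rename, diff]

theorem rename_mul (f : X → Y) (w₁ w₂ : List (ℤ × List X)) :
    rename f (mul w₁ w₂) = mul (rename f w₁) (rename f w₂) := by
  simp [rename, mul, List.map_flatMap, List.flatMap_map, Function.comp_def]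

theorem rename_combine (f : X → Y)
    (z : List (List (ℤ × List X) × List (ℤ × List X) × List (ℤ × List X) × ℕ)) :
    rename f (combine z) = combine (z.map
      (Prod.map (rename f) (Prod.map (rename f) (Prod.map (rename f) id)))) := by
  rw [combine, combine, rename, List.map_flatMap, List.flatMap_map]
  refine List.flatMap_congr fun q _ => ?_
  exact (rename_mul f _ _).trans (by rw [rename_mul]; rfl)

theorem isZero_rename [DecidableEq X] [DecidableEq Y] {f : X → Y} (hf : Function.Injective f)
    (w : List (ℤ × List X)) : IsZero (rename f w) ↔ IsZero w := by
  have h : ∀ l, coeffAt (rename f w) (l.map f) = coeffAt w l := by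
    intro l
    simp [coeffAt, rename, Function.comp_def, (List.map_injective_iff.2 hf).eq_iff]
  simp only [IsZero, rename, List.forall_mem_map, Prod.map_snd]
  exact forall₂_congr fun t _ => by rw [← h]; rfl

theorem mem_range_rename_val {n : ℕ} {v : List (ℤ × List ℕ)} :
    v ∈ Set.range (rename (Fin.val : Fin n → ℕ)) ↔ ∀ t ∈ v, ∀ x ∈ t.2, x < n := by
  have h : rename (Fin.val : Fin n → ℕ) = List.map (Prod.map id (List.map Fin.val)) := rfl
  rw [h, Set.range_list_map, Set.mem_ofPred_eq]
  refine forall₂_congr fun t _ => ?_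
  rw [Set.range_prodMap, Set.mem_prod, Set.range_list_map]
  simp

/-- The code of a word does not depend on the number of generators, so a program sees the same input
after renaming. -/
theorem encode_rename_val {n : ℕ} (w : Word n) :
    Encodable.encode (rename (Fin.val : Fin n → ℕ) w) = Encodable.encode w := by
  have h : ∀ l : List (Fin n), Encodable.encode (l.map Fin.val) = Encodable.encode l := by
    intro l
    induction l with
    | nil => rfl
    | cons x l ih => rw [List.map_cons, Encodable.encode_list_cons, Encodable.encode_list_cons, ih]; rfl
  induction w with
  | nil => rfl
  | cons t w ih =>
    rw [rename] at ih
    rw [rename, List.map_cons, Encodable.encode_list_cons, ih, Encodable.encode_list_cons]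
    congr 2
    exact congrArg (Nat.pair (Encodable.encode t.1)) (h t.2)

end Word

/-! ### The upper bound -/

/-- Words in generators `x₀, x₁, …`. -/
abbrev NatWord : Type := List (ℤ × List ℕ)

/-- The word only uses the first `n` generators. -/
def NatWord.IsBounded (n : ℕ) (v : NatWord) : Prop := ∀ t ∈ v, ∀ x ∈ t.2, x < n

/-- The list `z` of multiples of relators witnesses that two words have the same value; the relators
are the words `v` with `T v t` for some `t`. -/
def Derives (n : ℕ) (T : NatWord → ℕ → Prop) (v₁ v₂ : NatWord)
    (z : List (NatWord × NatWord × NatWord × ℕ)) : Prop :=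
  (∀ q ∈ z, NatWord.IsBounded n q.1 ∧ NatWord.IsBounded n q.2.1 ∧
    NatWord.IsBounded n q.2.2.1 ∧ T q.2.1 q.2.2.2) ∧
  Word.IsZero (Word.diff (Word.diff v₁ v₂) (Word.combine z))

/-- The type `Word (gens i)` varies with `i`. Moving to words over `ℕ` with a boundedness condition
gives one fixed type, on which primitive recursiveness uniform in `i` makes sense. -/
theorem wordProblem_iff_derives {n : ℕ} {R : Set (Word n)} {T : NatWord → ℕ → Prop}
    (hT : ∀ w : Word n, w ∈ R ↔ ∃ t, T (Word.rename Fin.val w) t) (w₁ w₂ : Word n) :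
    (wordProblem R).r w₁ w₂ ↔
      ∃ z, Derives n T (Word.rename Fin.val w₁) (Word.rename Fin.val w₂) z := by
  rw [Word.wordProblem_iff_exists hT]
  set F : Word n × Word n × Word n × ℕ → NatWord × NatWord × NatWord × ℕ :=
    Prod.map (Word.rename Fin.val) (Prod.map (Word.rename Fin.val)
      (Prod.map (Word.rename Fin.val) id))
  have hzero : ∀ z, Word.IsZero (Word.diff (Word.diff (Word.rename Fin.val w₁)
      (Word.rename Fin.val w₂)) (Word.combine (z.map F))) ↔
      Word.IsZero (Word.diff (Word.diff w₁ w₂) (Word.combine z)) := by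
    intro z
    rw [← Word.isZero_rename Fin.val_injective, Word.rename_diff, Word.rename_diff,
      Word.rename_combine]
  constructor
  · rintro ⟨z, hz, h0⟩
    refine ⟨z.map F, fun q hq => ?_, (hzero z).2 h0⟩
    obtain ⟨q, hq', rfl⟩ := List.mem_map.1 hq
    exact ⟨Word.mem_range_rename_val.1 ⟨_, rfl⟩, Word.mem_range_rename_val.1 ⟨_, rfl⟩,
      Word.mem_range_rename_val.1 ⟨_, rfl⟩, hz q hq'⟩
  · rintro ⟨z, hz, h0⟩
    obtain ⟨z, rfl⟩ : z ∈ Set.range (List.map F) := by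
      rw [Set.range_list_map]
      intro q hq
      obtain ⟨h1, h2, h3, -⟩ := hz q hq
      obtain ⟨u, hu⟩ := Word.mem_range_rename_val.2 h1
      obtain ⟨r, hr⟩ := Word.mem_range_rename_val.2 h2
      obtain ⟨v, hv⟩ := Word.mem_range_rename_val.2 h3
      exact ⟨(u, r, v, q.2.2.2), Prod.ext hu (Prod.ext hr (Prod.ext hv rfl))⟩
    exact ⟨z, fun q hq => (hz _ (List.mem_map_of_mem hq)).2.2.2, (hzero z).1 h0⟩

section Primrec

variable {α X : Type*} [Primcodable α] [Primcodable X]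

theorem primrec_mul : Primrec₂ (Word.mul (X := X)) :=
  Primrec.list_flatMap Primrec.fst (Primrec.list_map (Primrec.snd.comp Primrec.fst)
    ((primrec_int_mul.comp (Primrec.fst.comp (Primrec.snd.comp Primrec.fst))
      (Primrec.fst.comp Primrec.snd)).pair
      (Primrec.list_append.comp (Primrec.snd.comp (Primrec.snd.comp Primrec.fst))
        (Primrec.snd.comp Primrec.snd))).to₂).to₂

theorem primrec_combine : Primrec (Word.combine (X := X)) :=
  Primrec.list_flatMap Primrec.id (primrec_mul.comp
    (primrec_mul.comp (Primrec.fst.comp Primrec.snd)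
      (Primrec.fst.comp (Primrec.snd.comp Primrec.snd)))
    (Primrec.fst.comp (Primrec.snd.comp (Primrec.snd.comp Primrec.snd)))).to₂

theorem primrecPred_isZero [DecidableEq X] : PrimrecPred (Word.IsZero (X := X)) :=
  primrecPred_forall_mem Primrec.id (Primrec.eq.comp
    (primrec_coeffAt.comp Primrec.fst (Primrec.snd.comp Primrec.snd)) (Primrec.const 0))

theorem primrecPred_isBounded {n : α → ℕ} {v : α → NatWord} (hn : Primrec n) (hv : Primrec v) :
    PrimrecPred fun x => NatWord.IsBounded (n x) (v x) :=
  primrecPred_forall_mem hv (primrecPred_forall_mem (Primrec.snd.comp Primrec.snd)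
    (Primrec.nat_lt.comp Primrec.snd (hn.comp (Primrec.fst.comp Primrec.fst))))

theorem primrec_gens : Primrec gens := Primrec.fst.comp (Primrec.ofNat (ℕ × Code))

theorem primrec_prog : Primrec prog := Primrec.snd.comp (Primrec.ofNat (ℕ × Code))

theorem primrecPred_derives {T : ℕ → NatWord → ℕ → Prop}
    (hT : PrimrecPred fun q : ℕ × NatWord × ℕ => T q.1 q.2.1 q.2.2) {i : α → ℕ}
    {v₁ v₂ : α → NatWord} {z : α → List (NatWord × NatWord × NatWord × ℕ)}
    (hi : Primrec i) (h₁ : Primrec v₁) (h₂ : Primrec v₂) (hz : Primrec z) :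
    PrimrecPred fun x => Derives (gens (i x)) (T (i x)) (v₁ x) (v₂ x) (z x) := by
  have hq1 : Primrec fun x : α × NatWord × NatWord × NatWord × ℕ => x.2.1 :=
    Primrec.fst.comp Primrec.snd
  have hq2 : Primrec fun x : α × NatWord × NatWord × NatWord × ℕ => x.2.2.1 :=
    Primrec.fst.comp (Primrec.snd.comp Primrec.snd)
  have hq3 : Primrec fun x : α × NatWord × NatWord × NatWord × ℕ => x.2.2.2.1 :=
    Primrec.fst.comp (Primrec.snd.comp (Primrec.snd.comp Primrec.snd))
  have hq4 : Primrec fun x : α × NatWord × NatWord × NatWord × ℕ => x.2.2.2.2 :=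
    Primrec.snd.comp (Primrec.snd.comp (Primrec.snd.comp Primrec.snd))
  have hi' := hi.comp (Primrec.fst (α := α) (β := NatWord × NatWord × NatWord × ℕ))
  have hg := primrec_gens.comp hi'
  refine PrimrecPred.and (primrecPred_forall_mem hz ?_) ?_
  · exact (primrecPred_isBounded hg hq1).and ((primrecPred_isBounded hg hq2).and
      ((primrecPred_isBounded hg hq3).and (hT.comp (hi'.pair (hq2.pair hq4)))))
  · exact primrecPred_isZero.comp (primrec_diff.comp (primrec_diff.comp h₁ h₂)
      (primrec_combine.comp hz))

end Primrec

/-! ### Prenex forms of the two clauses of darkness. -/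

theorem isPi03_of_primrecPred {α β γ : Type} [Primcodable α] [Primcodable β] [Primcodable γ]
    [Inhabited α] [Inhabited β] [Inhabited γ] {A : Set ℕ} {D : ℕ × α × β × γ → Prop}
    (hD : PrimrecPred D) (h : ∀ x, x ∈ A ↔ ∀ a, ∃ b, ∀ c, D (x, a, b, c)) : IsPi03 A := by
  have hdec : ∀ {δ : Type} [Primcodable δ] [Inhabited δ],
      Primrec fun n : ℕ => (Encodable.decode n : Option δ).getD default :=
    Primrec.option_getD.comp Primrec.decode (Primrec.const _)
  -- Numbers that code nothing are read as `default`, so decoding is total and surjective and no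
  -- quantifier changes its meaning.
  refine ⟨fun q => D (q.1, (Encodable.decode q.2.1).getD default,
    (Encodable.decode q.2.2.1).getD default, (Encodable.decode q.2.2.2).getD default), ?_,
    fun x => ?_⟩
  · exact (hD.comp (Primrec.fst.pair ((hdec.comp (Primrec.fst.comp Primrec.snd)).pair
      ((hdec.comp (Primrec.fst.comp (Primrec.snd.comp Primrec.snd))).pair
        (hdec.comp (Primrec.snd.comp (Primrec.snd.comp Primrec.snd))))))).computablePred
  · rw [h, (Encodable.surjective_decode_getD α default).forall]
    refine forall_congr' fun a => ?_
    rw [(Encodable.surjective_decode_getD β default).exists]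
    refine exists_congr fun b => ?_
    rw [(Encodable.surjective_decode_getD γ default).forall]

theorem IsPi03.inter {A B : Set ℕ} (hA : IsPi03 A) (hB : IsPi03 B) : IsPi03 (A ∩ B) := by
  obtain ⟨P, hP, hA⟩ := hA.exists_primrecPred
  obtain ⟨Q, hQ, hB⟩ := hB.exists_primrecPred
  have h1 := Primrec.fst.comp (Primrec.snd (α := ℕ) (β := (ℕ × ℕ) × (ℕ × ℕ) × (ℕ × ℕ)))
  have h2 := Primrec.fst.comp (Primrec.snd.comp
    (Primrec.snd (α := ℕ) (β := (ℕ × ℕ) × (ℕ × ℕ) × (ℕ × ℕ))))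
  have h3 := Primrec.snd.comp (Primrec.snd.comp
    (Primrec.snd (α := ℕ) (β := (ℕ × ℕ) × (ℕ × ℕ) × (ℕ × ℕ))))
  refine isPi03_of_primrecPred (α := ℕ × ℕ) (β := ℕ × ℕ) (γ := ℕ × ℕ)
    (D := fun q => P (q.1, q.2.1.1, q.2.2.1.1, q.2.2.2.1) ∧
      Q (q.1, q.2.1.2, q.2.2.1.2, q.2.2.2.2)) ?_ fun x => ?_
  · exact (hP.comp (Primrec.fst.pair ((Primrec.fst.comp h1).pair
      ((Primrec.fst.comp h2).pair (Primrec.fst.comp h3))))).and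
      (hQ.comp (Primrec.fst.pair ((Primrec.snd.comp h1).pair
        ((Primrec.snd.comp h2).pair (Primrec.snd.comp h3)))))
  · rw [Set.mem_inter_iff, hA, hB]
    constructor
    · rintro ⟨h, h'⟩ ⟨a, a'⟩
      obtain ⟨b, hb⟩ := h a
      obtain ⟨b', hb'⟩ := h' a'
      exact ⟨(b, b'), fun c => ⟨hb c.1, hb' c.2⟩⟩
    · intro h
      constructor
      · intro a
        obtain ⟨b, hb⟩ := h (a, a)
        exact ⟨b.1, fun c => (hb (c, c)).1⟩
      · intro a
        obtain ⟨b, hb⟩ := h (a, a)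
        exact ⟨b.2, fun c => (hb (c, c)).2⟩

/-- There are finitely many classes exactly when the elements with code below some `N` meet them
all. -/
theorem infinite_quotient_iff {α : Type*} [Encodable α] (E : Setoid α) :
    Infinite (Quotient E) ↔ ∀ N, ∃ w, ∀ v, Encodable.encode v < N → ¬ E.r v w := by
  constructor
  · intro hinf N
    by_contra! hall
    have hfin : {v : α | Encodable.encode v < N}.Finite :=
      (Set.finite_lt_nat N).preimage Encodable.encode_injective.injOn
    have := hfin.to_subtype
    refine hinf.not_finite (Finite.of_surjective
      (fun v : {v : α | Encodable.encode v < N} => (Quotient.mk E v.1)) fun q => ?_)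
    obtain ⟨w, rfl⟩ := Quotient.exists_rep q
    obtain ⟨v, hv, hvw⟩ := hall w
    exact ⟨⟨v, hv⟩, Quotient.sound hvw⟩
  · intro h
    by_contra hfin
    rw [not_infinite_iff_finite] at hfin
    obtain ⟨N, hN⟩ := (Set.finite_range fun q : Quotient E => Encodable.encode q.out).bddAbove
    obtain ⟨w, hw⟩ := h (N + 1)
    refine hw (Quotient.mk E w).out ?_ (Quotient.exact (Quotient.out_eq _))
    exact Nat.lt_succ_of_le (hN ⟨_, rfl⟩)

/-- Programs enumerate all c.e. sets, and such a set is finite exactly when its codes are bounded.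
-/
theorem not_isLight_iff {α : Type*} [Primcodable α] (E : Setoid α) :
    ¬ IsLight E ↔ ∀ c : Code,
      (∃ N, ∀ a : α, (c.eval (Encodable.encode a)).Dom → Encodable.encode a < N) ∨
      ∃ a b : α, a ≠ b ∧ (c.eval (Encodable.encode a)).Dom ∧ (c.eval (Encodable.encode b)).Dom ∧
        E.r a b := by
  constructor
  · intro h c
    by_contra! ⟨hinf, hne⟩
    refine h ⟨{a | (c.eval (Encodable.encode a)).Dom}, rePred_eval_dom c, ?_,
      fun a ha b hb hab => hne a b hab ha hb⟩
    intro hfin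
    obtain ⟨N, hN⟩ := (hfin.image Encodable.encode).bddAbove
    obtain ⟨a, ha, hNa⟩ := hinf (N + 1)
    have := hN ⟨a, ha, rfl⟩
    omega
  · rintro h ⟨W, hW, hinf, hne⟩
    obtain ⟨c, hc⟩ := exists_code_of_rePred hW
    rcases h c with ⟨N, hN⟩ | ⟨a, b, hab, ha, hb, hE⟩
    · refine hinf (((Set.finite_lt_nat N).preimage Encodable.encode_injective.injOn).subset ?_)
      exact fun a ha => hN a ((hc a).1 ha)
    · exact hne a ((hc a).2 ha) b ((hc b).2 hb) hab hE

theorem forall_isBounded_iff {n : ℕ} {P : NatWord → Prop} :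
    (∀ v, NatWord.IsBounded n v → P v) ↔ ∀ w : Word n, P (Word.rename Fin.val w) := by
  constructor
  · exact fun h w => h _ (Word.mem_range_rename_val.1 ⟨w, rfl⟩)
  · intro h v hv
    obtain ⟨w, rfl⟩ := Word.mem_range_rename_val.2 hv
    exact h w

theorem exists_isBounded_iff {n : ℕ} {P : NatWord → Prop} :
    (∃ v, NatWord.IsBounded n v ∧ P v) ↔ ∃ w : Word n, P (Word.rename Fin.val w) := by
  constructor
  · rintro ⟨v, hv, h⟩
    obtain ⟨w, rfl⟩ := Word.mem_range_rename_val.2 hv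
    exact ⟨w, h⟩
  · exact fun ⟨w, h⟩ => ⟨_, Word.mem_range_rename_val.1 ⟨w, rfl⟩, h⟩

section UpperBound

variable {R : ∀ i, Set (Word (gens i))} {T : ℕ → NatWord → ℕ → Prop}

theorem isPi03_infinite_quotient
    (hTp : PrimrecPred fun q : ℕ × NatWord × ℕ => T q.1 q.2.1 q.2.2)
    (hT : ∀ i, ∀ w : Word (gens i), w ∈ R i ↔ ∃ t, T i (Word.rename Fin.val w) t) :
    IsPi03 {i | Infinite (Quotient (wordProblem (R i)))} := by
  refine isPi03_of_primrecPred (α := ℕ) (β := NatWord)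
    (γ := NatWord × List (NatWord × NatWord × NatWord × ℕ))
    (D := fun q => NatWord.IsBounded (gens q.1) q.2.2.1 ∧
      (NatWord.IsBounded (gens q.1) q.2.2.2.1 → Encodable.encode q.2.2.2.1 < q.2.1 →
        ¬ Derives (gens q.1) (T q.1) q.2.2.2.1 q.2.2.1 q.2.2.2.2)) ?_ fun i => ?_
  · have hg := primrec_gens.comp (Primrec.fst (α := ℕ)
      (β := ℕ × NatWord × NatWord × List (NatWord × NatWord × NatWord × ℕ)))
    have h2 := Primrec.snd (α := ℕ)
      (β := ℕ × NatWord × NatWord × List (NatWord × NatWord × NatWord × ℕ))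
    have hw := Primrec.fst.comp (Primrec.snd.comp h2)
    have hv := Primrec.fst.comp (Primrec.snd.comp (Primrec.snd.comp h2))
    have hz := Primrec.snd.comp (Primrec.snd.comp (Primrec.snd.comp h2))
    exact (primrecPred_isBounded hg hw).and (primrecPred_imp (primrecPred_isBounded hg hv)
      (primrecPred_imp (Primrec.nat_lt.comp (Primrec.encode.comp hv) (Primrec.fst.comp h2))
        (primrecPred_derives hTp Primrec.fst hv hw hz).not))
  · rw [Set.mem_ofPred_eq, infinite_quotient_iff]
    refine forall_congr' fun N => ?_
    have h1 : ∀ w : NatWord, (∀ c : NatWord × List (NatWord × NatWord × NatWord × ℕ),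
        NatWord.IsBounded (gens i) w ∧ (NatWord.IsBounded (gens i) c.1 →
          Encodable.encode c.1 < N → ¬ Derives (gens i) (T i) c.1 w c.2)) ↔
        NatWord.IsBounded (gens i) w ∧ ∀ v, NatWord.IsBounded (gens i) v →
          Encodable.encode v < N → ∀ z, ¬ Derives (gens i) (T i) v w z := by
      intro w
      constructor
      · exact fun h => ⟨(h ([], [])).1, fun v hv hN z => (h (v, z)).2 hv hN⟩
      · exact fun h c => ⟨h.1, fun hv hN => h.2 c.1 hv hN c.2⟩
    simp only [h1]
    rw [exists_isBounded_iff]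
    refine exists_congr fun w => ?_
    rw [forall_isBounded_iff]
    refine forall_congr' fun v => ?_
    rw [Word.encode_rename_val, wordProblem_iff_derives (hT i), not_exists]

theorem isPi03_not_isLight
    (hTp : PrimrecPred fun q : ℕ × NatWord × ℕ => T q.1 q.2.1 q.2.2)
    (hT : ∀ i, ∀ w : Word (gens i), w ∈ R i ↔ ∃ t, T i (Word.rename Fin.val w) t) :
    IsPi03 {i | ¬ IsLight (wordProblem (R i))} := by
  refine isPi03_of_primrecPred (α := Code)
    (β := ℕ × NatWord × NatWord × ℕ × ℕ × List (NatWord × NatWord × NatWord × ℕ))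
    (γ := NatWord × ℕ)
    (D := fun q => (NatWord.IsBounded (gens q.1) q.2.2.2.1 →
        (Code.evaln q.2.2.2.2 q.2.1 (Encodable.encode q.2.2.2.1)).isSome →
        Encodable.encode q.2.2.2.1 < q.2.2.1.1) ∨
      (NatWord.IsBounded (gens q.1) q.2.2.1.2.1 ∧ NatWord.IsBounded (gens q.1) q.2.2.1.2.2.1 ∧
        q.2.2.1.2.1 ≠ q.2.2.1.2.2.1 ∧
        (Code.evaln q.2.2.1.2.2.2.1 q.2.1 (Encodable.encode q.2.2.1.2.1)).isSome ∧
        (Code.evaln q.2.2.1.2.2.2.2.1 q.2.1 (Encodable.encode q.2.2.1.2.2.1)).isSome ∧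
        Derives (gens q.1) (T q.1) q.2.2.1.2.1 q.2.2.1.2.2.1 q.2.2.1.2.2.2.2.2)) ?_ fun i => ?_
  · have hi := Primrec.fst (α := ℕ) (β := Code × (ℕ × NatWord × NatWord × ℕ × ℕ ×
      List (NatWord × NatWord × NatWord × ℕ)) × NatWord × ℕ)
    have hq := Primrec.snd (α := ℕ) (β := Code × (ℕ × NatWord × NatWord × ℕ × ℕ ×
      List (NatWord × NatWord × NatWord × ℕ)) × NatWord × ℕ)
    have hg := primrec_gens.comp hi
    have hc := Primrec.fst.comp hq
    have hb := Primrec.fst.comp (Primrec.snd.comp hq)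
    have hv := Primrec.fst.comp (Primrec.snd.comp (Primrec.snd.comp hq))
    have ht := Primrec.snd.comp (Primrec.snd.comp (Primrec.snd.comp hq))
    have hv₁ := Primrec.fst.comp (Primrec.snd.comp hb)
    have hv₂ := Primrec.fst.comp (Primrec.snd.comp (Primrec.snd.comp hb))
    have ht₁ := Primrec.fst.comp (Primrec.snd.comp (Primrec.snd.comp (Primrec.snd.comp hb)))
    have hb' := Primrec.snd.comp (Primrec.snd.comp (Primrec.snd.comp (Primrec.snd.comp hb)))
    refine PrimrecPred.or (primrecPred_imp (primrecPred_isBounded hg hv) (primrecPred_imp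
      (primrecPred_evaln_isSome.comp ((ht.pair hc).pair (Primrec.encode.comp hv)))
      (Primrec.nat_lt.comp (Primrec.encode.comp hv) (Primrec.fst.comp hb)))) ?_
    exact (primrecPred_isBounded hg hv₁).and ((primrecPred_isBounded hg hv₂).and
      ((Primrec.eq.comp hv₁ hv₂).not.and
      ((primrecPred_evaln_isSome.comp ((ht₁.pair hc).pair (Primrec.encode.comp hv₁))).and
      ((primrecPred_evaln_isSome.comp
        (((Primrec.fst.comp hb').pair hc).pair (Primrec.encode.comp hv₂))).and
        (primrecPred_derives hTp hi hv₁ hv₂ (Primrec.snd.comp hb'))))))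
  · rw [Set.mem_ofPred_eq, not_isLight_iff]
    refine forall_congr' fun c => ?_
    constructor
    · rintro (⟨N, hN⟩ | ⟨w₁, w₂, hne, h₁, h₂, hE⟩)
      -- The existential block holds the witnesses of both alternatives; those of the unused one are
      -- filled with dummies.
      · refine ⟨(N, [], [], 0, 0, []), fun q => Or.inl fun hv ht => ?_⟩
        obtain ⟨v, t⟩ := q
        dsimp only at hv ht ⊢
        obtain ⟨w, rfl⟩ := Word.mem_range_rename_val.2 hv
        rw [Word.encode_rename_val] at ht ⊢
        exact hN w (eval_dom_iff.2 ⟨t, ht⟩)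
      · obtain ⟨t₁, ht₁⟩ := eval_dom_iff.1 h₁
        obtain ⟨t₂, ht₂⟩ := eval_dom_iff.1 h₂
        obtain ⟨z, hz⟩ := (wordProblem_iff_derives (hT i) w₁ w₂).1 hE
        refine ⟨(0, Word.rename Fin.val w₁, Word.rename Fin.val w₂, t₁, t₂, z), fun q => Or.inr
          ⟨Word.mem_range_rename_val.1 ⟨w₁, rfl⟩, Word.mem_range_rename_val.1 ⟨w₂, rfl⟩,
            fun h => hne ?_, ?_, ?_, hz⟩⟩
        · have h' := congrArg Encodable.encode h
          dsimp only at h'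
          rw [Word.encode_rename_val, Word.encode_rename_val] at h'
          exact Encodable.encode_injective h'
        · rwa [Word.encode_rename_val]
        · rwa [Word.encode_rename_val]
    · rintro ⟨⟨N, v₁, v₂, t₁, t₂, z⟩, h⟩
      -- The second alternative does not involve the last universal variable, so deciding it once
      -- moves that quantifier back inside the disjunction.
      by_cases hr : NatWord.IsBounded (gens i) v₁ ∧ NatWord.IsBounded (gens i) v₂ ∧ v₁ ≠ v₂ ∧
          (Code.evaln t₁ c (Encodable.encode v₁)).isSome ∧
          (Code.evaln t₂ c (Encodable.encode v₂)).isSome ∧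
          Derives (gens i) (T i) v₁ v₂ z
      · obtain ⟨hv₁, hv₂, hne, h₁, h₂, hz⟩ := hr
        obtain ⟨w₁, rfl⟩ := Word.mem_range_rename_val.2 hv₁
        obtain ⟨w₂, rfl⟩ := Word.mem_range_rename_val.2 hv₂
        rw [Word.encode_rename_val] at h₁ h₂
        exact Or.inr ⟨w₁, w₂, fun h => hne (h ▸ rfl), eval_dom_iff.2 ⟨_, h₁⟩,
          eval_dom_iff.2 ⟨_, h₂⟩, (wordProblem_iff_derives (hT i) w₁ w₂).2 ⟨z, hz⟩⟩
      · refine Or.inl ⟨N, fun w hw => ?_⟩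
        obtain ⟨t, ht⟩ := eval_dom_iff.1 hw
        have := (h (Word.rename Fin.val w, t)).resolve_right hr
          (Word.mem_range_rename_val.1 ⟨w, rfl⟩)
        dsimp only at this
        rw [Word.encode_rename_val] at this
        exact this ht

theorem isPi03_isDark
    (hTp : PrimrecPred fun q : ℕ × NatWord × ℕ => T q.1 q.2.1 q.2.2)
    (hT : ∀ i, ∀ w : Word (gens i), w ∈ R i ↔ ∃ t, T i (Word.rename Fin.val w) t) :
    IsPi03 {i | IsDark (wordProblem (R i))} :=
  (isPi03_infinite_quotient hTp hT).inter (isPi03_not_isLight hTp hT)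

end UpperBound

/-! ### The two index sets. -/

theorem isPi03_darkCEIndices : IsPi03 darkCEIndices := by
  refine isPi03_isDark
    (T := fun i v t => (Code.evaln t (prog i) (Encodable.encode v)).isSome) ?_ fun i w => ?_
  · exact primrecPred_evaln_isSome.comp (((Primrec.snd.comp Primrec.snd).pair
      (primrec_prog.comp Primrec.fst)).pair
      (Primrec.encode.comp (Primrec.fst.comp Primrec.snd)))
  · rw [Word.encode_rename_val]
    exact eval_dom_iff

theorem primrecPred_evaln_eq (x : ℕ) : PrimrecPred fun q : ℕ × NatWord × ℕ =>
    Code.evaln q.2.2 (prog q.1) (Encodable.encode q.2.1) = some x :=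
  Primrec.eq.comp (Code.primrec_evaln.comp (((Primrec.snd.comp Primrec.snd).pair
    (primrec_prog.comp Primrec.fst)).pair
    (Primrec.encode.comp (Primrec.fst.comp Primrec.snd)))) (Primrec.const (some x))

theorem isPi03_isComputableIndex : IsPi03 {i | IsComputableIndex i} := by
  -- The condition is only `∀ ∃`; the last quantifier is a dummy.
  refine isPi03_of_primrecPred (α := NatWord) (β := ℕ) (γ := ℕ)
    (D := fun q => NatWord.IsBounded (gens q.1) q.2.1 →
      Code.evaln q.2.2.1 (prog q.1) (Encodable.encode q.2.1) = some 0 ∨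
      Code.evaln q.2.2.1 (prog q.1) (Encodable.encode q.2.1) = some 1) ?_ fun i => ?_
  · have h : Primrec fun q : ℕ × NatWord × ℕ × ℕ => (q.1, q.2.1, q.2.2.1) :=
      Primrec.fst.pair ((Primrec.fst.comp Primrec.snd).pair
        (Primrec.fst.comp (Primrec.snd.comp Primrec.snd)))
    exact primrecPred_imp (primrecPred_isBounded (primrec_gens.comp Primrec.fst)
      (Primrec.fst.comp Primrec.snd))
      (((primrecPred_evaln_eq 0).comp h).or ((primrecPred_evaln_eq 1).comp h))
  · have h : ∀ v : NatWord, (∃ t : ℕ, ∀ _ : ℕ, NatWord.IsBounded (gens i) v →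
        Code.evaln t (prog i) (Encodable.encode v) = some 0 ∨
        Code.evaln t (prog i) (Encodable.encode v) = some 1) ↔
        (NatWord.IsBounded (gens i) v → 0 ∈ (prog i).eval (Encodable.encode v) ∨
          1 ∈ (prog i).eval (Encodable.encode v)) := by
      intro v
      simp only [Code.evaln_complete, Option.mem_def, ← exists_or, forall_const]
      constructor
      · exact fun ⟨t, ht⟩ hv => ⟨t, ht hv⟩
      · intro h
        by_cases hv : NatWord.IsBounded (gens i) v
        · obtain ⟨t, ht⟩ := h hv
          exact ⟨t, fun _ => ht⟩
        · exact ⟨0, fun hv' => absurd hv' hv⟩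
    simp only [h]
    rw [forall_isBounded_iff]
    simp only [Word.encode_rename_val]
    rfl

theorem isPi03_darkComputableIndices : IsPi03 darkComputableIndices := by
  refine isPi03_isComputableIndex.inter (isPi03_isDark
    (T := fun i v t => Code.evaln t (prog i) (Encodable.encode v) = some 1)
    (primrecPred_evaln_eq 1) fun i w => ?_)
  rw [Word.encode_rename_val]
  exact Code.evaln_complete

end DarkRings

theorem mainTheorem10 :
    DarkRings.IsPi03Complete DarkRings.darkComputableIndices ∧
    DarkRings.IsPi03Complete DarkRings.darkCEIndices ∧
    ∀ p : ℕ, p.Prime → ∀ S : Set ℕ, DarkRings.IsPi03 S →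
      ∃ f : ℕ → ℕ, Computable f ∧ ∀ i : ℕ,
        DarkRings.IsComputableIndex (f i) ∧
        DarkRings.IsGolodShafarevichRing p
          (DarkRings.PresentedRing (DarkRings.computableRelators (f i))) ∧
        (i ∈ S ↔ f i ∈ DarkRings.darkComputableIndices) := by
  refine ⟨⟨DarkRings.isPi03_darkComputableIndices, fun B hB => ?_⟩,
    ⟨DarkRings.isPi03_darkCEIndices, fun B hB => ?_⟩,
    fun p hp S hS => DarkRings.exists_reduction_darkComputableIndices hp hS⟩
  · obtain ⟨f, hf, h⟩ := DarkRings.exists_reduction_darkComputableIndices Nat.prime_two hB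
    exact ⟨f, hf, fun i => (h i).2.2⟩
  · obtain ⟨f, hf, h⟩ := DarkRings.exists_reduction_darkCEIndices hB
    exact ⟨f, hf, h⟩
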